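/- **Theorem 4.10.** Let $n\ge 1$ be an integer and $\mu>0$. *Notation.* Let $\mathbb D^n$ be the open unit polydisc, $\boldsymbol s=(s_1,\dots,s_n):\mathbb C^n\to\mathbb C^n$ the map whose components are the elementary symmetric polynomials, $\mathbb G_n=\boldsymbol s(\mathbb D^n)$ the symmetrized polydisc, and $\Delta(\boldsymbol z)=\prod_{i<j}(z_i-z_j)$. Let $[n]$ be the set of weakly decreasing $n$-tuples $\boldsymbol p=(p_1,\dots,p_n)$ of nonnegative integers and $\boldsymbol\delta=(n-1,n-2,\dots,1,0)$. For $\boldsymbol m\in\mathbb Z_{\ge0}^n$ put $\boldsymbol m!=\prod_j m_j!$, $(\mu)_{\boldsymbol m}=\prod_j (\mu)_{m_j}$ with $(\mu)_k=\mu(\mu+1)\cdots(\mu+k-1)$, and $a_{\boldsymbol m}=\det(z_i^{m_j})_{i,j=1}^n$. For $\boldsymbol p\in[n]$ let $S_{\boldsymbol p}=a_{\boldsymbol p+\boldsymbol\delta}/a_{\boldsymbol\delta}$ be the Schur polynomial and $\gamma_{\boldsymbol p}^2=(\mu)_{\boldsymbol p+\boldsymbol\delta}/(\boldsymbol p+\boldsymbol\delta)!$.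 *The space $\mathbb A^{(\mu)}(\mathbb G_n)$.* For $\mu>1$ it consists of the holomorphic functions $f$ on $\mathbb G_n$ with $$\|f\|^2=\frac1{n!}\int_{\mathbb D^n}|f\circ\boldsymbol s|^2|\Delta|^2\Big(\frac{\mu-1}{\pi}\Big)^n\prod_{i=1}^n(1-|z_i|^2)^{\mu-2}\,dA(z_1)\cdots dA(z_n)<\infty ,$$ where $dA$ is Lebesgue measure on $\mathbb C$. For $\mu=1$ it is the Hardy space of the holomorphic functions $f$ on $\mathbb G_n$ with $$\|f\|^2=\sup_{0<r<1}\frac1{n!\,(2\pi)^n}\int_{[0,2\pi]^n}|f(\boldsymbol s(re^{i\theta}))|^2\,|\Delta(re^{i\theta})|^2\,d\theta<\infty,\qquad re^{i\theta}=(re^{i\theta_1},\dots,re^{i\theta_n}).$$ For $0<\mu<1$ it is the Hilbert space of holomorphic functions on $\mathbb G_n$ whose reproducing kernel takes the value $\sum_{\boldsymbol p\in[n]}\gamma_{\boldsymbol p}^2S_{\boldsymbol p}(\boldsymbol z)\overline{S_{\boldsymbol p}(\boldsymbol w)}$ at $(\boldsymbol s(\boldsymbol z),\boldsymbol s(\boldsymbol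 w))$, for $\boldsymbol z,\boldsymbol w\in\mathbb D^n$. *Normalization.* A kernel $K$ on $\mathbb G_n$ is normalized at $\boldsymbol 0$ if $K(\boldsymbol s,\boldsymbol 0)=1$ for all $\boldsymbol s$ in a neighbourhood of $\boldsymbol 0$; the normalization of $K$ at $\boldsymbol 0$ is $\widetilde K(\boldsymbol s,\boldsymbol t)=K(\boldsymbol 0,\boldsymbol 0)\,K(\boldsymbol s,\boldsymbol 0)^{-1}K(\boldsymbol s,\boldsymbol t)\,K(\boldsymbol 0,\boldsymbol t)^{-1}$. *Statement.* The space $\mathbb A^{(\mu)}(\mathbb G_n)$ is a reproducing kernel Hilbert space (in particular, it exists when $0<\mu<1$). Let $\mathbf B^{(\mu)}_{\mathbb G_n}$ be its reproducing kernel and $\widetilde{\mathbf B}^{(\mu)}_{\mathbb G_n}$ the normalization of that kernel at $\boldsymbol 0$. Then $\widetilde{\mathbf B}^{(\mu)}_{\mathbb G_n}=\frac{\boldsymbol\delta!}{(\mu)_{\boldsymbol\delta}}\mathbf B^{(\mu)}_{\mathbb G_n}$ is normalized at $\boldsymbol 0$, and for all $\boldsymbol s=(s_1,\dots,s_n)$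 and $\boldsymbol t=(t_1,\dots,t_n)$ in $\mathbb G_n$ $$\widetilde{\mathbf B}^{(\mu)}_{\mathbb G_n}(\boldsymbol s,\boldsymbol t)=\frac{\boldsymbol\delta!}{(\mu)_{\boldsymbol\delta}}\sum_{\boldsymbol p\in[n]}\gamma_{\boldsymbol p}^2\,\det\big(s_{p_i'+j-i}\big)_{i,j=1}^{r}\;\overline{\det\big(t_{p_i'+j-i}\big)_{i,j=1}^{r}},$$ where the series converges absolutely. Here $\boldsymbol p'=(p_1',\dots,p_r')$, with $p_r'>0$, is the partition conjugate to $\boldsymbol p$ (so $r=p_1$), $s_0=t_0=1$, $s_k=t_k=0$ for $k<0$ and for $k>n$, and the empty determinant ($\boldsymbol p=\boldsymbol 0$) is $1$. -/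

import Mathlib

namespace SymmetrizedPolydisc

open MeasureTheory Set Filter Topology
open scoped ENNReal ComplexConjugate

noncomputable section

/-! ### The symmetrized polydisc -/

/-- The open unit polydisc `𝔻ⁿ` in `ℂⁿ`. -/
def polydisc (n : ℕ) : Set (Fin n → ℂ) := {z | ∀ i, ‖z i‖ < 1}

/-- The symmetrization map `𝐬 = (s₁, …, sₙ) : ℂⁿ → ℂⁿ`; the entry with (zero-based) index `k` is
the elementary symmetric polynomial of degree `k + 1`. -/
def symMap {n : ℕ} (z : Fin n → ℂ) : Fin n → ℂ := fun k =>
  ∑ t ∈ (Finset.univ : Finset (Fin n)).powersetCard ((k : ℕ) + 1), ∏ i ∈ t, z i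

/-- The symmetrized polydisc `𝔾ₙ = 𝐬(𝔻ⁿ)`. -/
def symPolydisc (n : ℕ) : Set (Fin n → ℂ) := symMap '' polydisc n

/-- The symmetrization map as a map from `𝔻ⁿ` to `𝔾ₙ`. -/
def symMapOn (n : ℕ) (z : polydisc n) : symPolydisc n :=
  ⟨symMap (z : Fin n → ℂ), mem_image_of_mem _ z.2⟩

/-- The origin of `ℂⁿ`, as a point of `𝔻ⁿ`. -/
def polydiscZero (n : ℕ) : polydisc n := ⟨0, by intro i; simp⟩

/-- The origin of `ℂⁿ`, as a point of `𝔾ₙ`. -/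
def origin (n : ℕ) : symPolydisc n := ⟨0, 0, (polydiscZero n).2, by
  funext k
  refine Finset.sum_eq_zero fun t ht => ?_
  have hc := (Finset.mem_powersetCard.mp ht).2
  have hne : t.Nonempty := Finset.card_pos.mp (by omega)
  obtain ⟨i, hi⟩ := hne
  exact Finset.prod_eq_zero hi rfl⟩

/-- Holomorphic functions on `𝔾ₙ`. -/
def IsHolomorphic {n : ℕ} (f : symPolydisc n → ℂ) : Prop :=
  ∃ g : (Fin n → ℂ) → ℂ, DifferentiableOn ℂ g (symPolydisc n) ∧ ∀ u : symPolydisc n, f u = g u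

/-- `Δ(z) = ∏_{i < j} (z_i - z_j)`, the complex Jacobian of the symmetrization map. -/
def jac {n : ℕ} (z : Fin n → ℂ) : ℂ := ∏ i : Fin n, ∏ j ∈ Finset.Ioi i, (z i - z j)

/-! ### Multi-indices -/

/-- `[n]`: the weakly decreasing `n`-tuples of nonnegative integers. -/
def Parts (n : ℕ) : Type := {p : Fin n → ℕ // Antitone p}

/-- `δ = (n - 1, n - 2, …, 1, 0)`. -/
def delta (n : ℕ) : Fin n → ℕ := fun i => n - 1 - (i : ℕ)

/-- `𝐦! = ∏_j m_j!`. -/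
def multiFactorial {n : ℕ} (m : Fin n → ℕ) : ℝ := ∏ j, ((m j).factorial : ℝ)

/-- `(μ)_𝐦 = ∏_j (μ)_{m_j}` with `(μ)_k = μ (μ + 1) ⋯ (μ + k - 1)`. -/
def multiPochhammer {n : ℕ} (μ : ℝ) (m : Fin n → ℕ) : ℝ :=
  ∏ j, (ascPochhammer ℝ (m j)).eval μ

/-- `γ_𝐩² = (μ)_{𝐩 + δ} / (𝐩 + δ)!`. -/
def gammaSq {n : ℕ} (μ : ℝ) (p : Parts n) : ℝ :=
  multiPochhammer μ (p.1 + delta n) / multiFactorial (p.1 + delta n)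

/-! ### Schur polynomials -/

/-- The alternant `a_𝐦 = det (z_i ^ m_j)`. -/
def alternant {n : ℕ} (m : Fin n → ℕ) : MvPolynomial (Fin n) ℂ :=
  (Matrix.of fun i j : Fin n => (MvPolynomial.X i : MvPolynomial (Fin n) ℂ) ^ m j).det

/-- Every alternant is divisible by `a_δ`. -/
theorem alternant_delta_dvd {n : ℕ} (m : Fin n → ℕ) : alternant (delta n) ∣ alternant m := by
  classical
  let x : Fin n → MvPolynomial (Fin n) ℂ := MvPolynomial.X
  let P : Polynomial (MvPolynomial (Fin n) ℂ) := ∏ k, (Polynomial.X - Polynomial.C (x k))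
  have hP : P.Monic := Polynomial.monic_prod_of_monic _ _ fun k _ => Polynomial.monic_X_sub_C _
  have hdeg : P.natDegree = n := by
    simp [P, Polynomial.natDegree_prod_of_monic _ _ fun k _ => Polynomial.monic_X_sub_C (x k)]
  have key : ∀ (i : Fin n) (q : Polynomial (MvPolynomial (Fin n) ℂ)),
      q.eval (x i) = (q %ₘ P).eval (x i) := by
    intro i q
    have h0 : P.eval (x i) = 0 := by
      simp only [P, Polynomial.eval_prod]
      exact Finset.prod_eq_zero (Finset.mem_univ i) (by simp)
    conv_lhs => rw [← Polynomial.modByMonic_add_div q P]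
    simp [h0]
  refine ⟨(Matrix.of fun l j : Fin n =>
    ((Polynomial.X ^ m j : Polynomial (MvPolynomial (Fin n) ℂ)) %ₘ P).coeff (delta n l)).det, ?_⟩
  rw [alternant, alternant, ← Matrix.det_mul]
  congr 1
  ext1 i j
  have h1 := key i (Polynomial.X ^ m j)
  have hlt : ((Polynomial.X ^ m j : Polynomial (MvPolynomial (Fin n) ℂ)) %ₘ P).natDegree < n := by
    have hn : P ≠ 1 := by
      intro h
      have := i.2
      rw [h, Polynomial.natDegree_one] at hdeg
      omega
    have := Polynomial.natDegree_modByMonic_lt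
      (Polynomial.X ^ m j : Polynomial (MvPolynomial (Fin n) ℂ)) hP hn
    omega
  rw [Polynomial.eval_eq_sum_range' hlt, Polynomial.eval_pow, Polynomial.eval_X,
    ← Finset.sum_range_reflect, Finset.sum_range] at h1
  simp only [Matrix.of_apply, Matrix.mul_apply]
  rw [show (MvPolynomial.X i : MvPolynomial (Fin n) ℂ) = x i from rfl, h1]
  exact Finset.sum_congr rfl fun l _ => mul_comm _ _

/-- The Schur polynomial `S_𝐩 = a_{𝐩 + δ} / a_δ`. -/
def schur {n : ℕ} (p : Parts n) : MvPolynomial (Fin n) ℂ :=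
  (alternant_delta_dvd (p.1 + delta n)).choose

/-- The function `∑_{𝐩 ∈ [n]} γ_𝐩² S_𝐩(z) conj (S_𝐩(w))` on `𝔻ⁿ × 𝔻ⁿ`. -/
def schurSeries {n : ℕ} (μ : ℝ) (z w : polydisc n) : ℂ :=
  ∑' p : Parts n, (gammaSq μ p : ℂ) * MvPolynomial.eval (z : Fin n → ℂ) (schur p) *
    conj (MvPolynomial.eval (w : Fin n → ℂ) (schur p))

/-! ### The weighted Bergman spaces on the symmetrized polydisc -/

/-- The probability measure `dV^(μ) = ((μ - 1)/π)ⁿ ∏ (1 - |z_i|²)^(μ - 2) dA(z_i)` on `𝔻ⁿ`,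
for `μ > 1`. -/
def polydiscMeasure (n : ℕ) (μ : ℝ) : Measure (polydisc n) :=
  ((volume : Measure (Fin n → ℂ)).comap Subtype.val).withDensity fun z =>
    ENNReal.ofReal (((μ - 1) / Real.pi) ^ n *
      ∏ i, (1 - ‖(z : Fin n → ℂ) i‖ ^ 2) ^ (μ - 2))

/-- The measure `dV_𝐬^(μ)` on `𝔾ₙ`, given by
`∫_{𝔾ₙ} f dV_𝐬^(μ) = (1 / n!) ∫_{𝔻ⁿ} (f ∘ 𝐬) |Δ|² dV^(μ)`. -/
def symMeasure (n : ℕ) (μ : ℝ) : Measure (symPolydisc n) :=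
  ((polydiscMeasure n μ).withDensity fun z =>
    ENNReal.ofReal (‖jac (z : Fin n → ℂ)‖ ^ 2 / (n.factorial : ℝ))).map (symMapOn n)

/-- The square of the norm of `L²(𝔾ₙ, dV_𝐬^(μ))`. -/
def bergmanNormSq {n : ℕ} (μ : ℝ) (f : symPolydisc n → ℂ) : ℝ≥0∞ :=
  ∫⁻ u, ‖f u‖ₑ ^ 2 ∂(symMeasure n μ)

/-- The point `(r e^{iθ₁}, …, r e^{iθₙ})` of `𝔻ⁿ`, for `0 < r < 1`. -/
def torusPoint {n : ℕ} (r : Ioo (0 : ℝ) 1) (θ : Fin n → ℝ) : polydisc n :=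
  ⟨fun j => ((r : ℝ) : ℂ) * Complex.exp (θ j * Complex.I), by
    intro j
    simp only [norm_mul, Complex.norm_exp_ofReal_mul_I, mul_one, Complex.norm_real,
      Real.norm_eq_abs, abs_of_pos r.2.1]
    exact r.2.2⟩

/-- The square of the Hardy space norm on `𝔾ₙ`:
`sup_{0 < r < 1} (1 / n!) (2π)⁻ⁿ ∫_{[0, 2π]ⁿ} |f(𝐬(r e^{iθ}))|² |Δ(r e^{iθ})|² dθ`. -/
def hardyNormSq {n : ℕ} (f : symPolydisc n → ℂ) : ℝ≥0∞ :=
  ⨆ r : Ioo (0 : ℝ) 1,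
    ENNReal.ofReal (1 / ((n.factorial : ℝ) * (2 * Real.pi) ^ n)) *
      ∫⁻ θ in Icc (0 : Fin n → ℝ) (fun _ => 2 * Real.pi),
        ‖f (symMapOn n (torusPoint r θ))‖ₑ ^ 2 * ‖jac (torusPoint r θ : Fin n → ℂ)‖ₑ ^ 2

/-- The scalar reproducing kernel `K(u, v)` of a reproducing kernel Hilbert space of
complex-valued functions: `K(u, v) = K_v(u)`, where `⟨f, K_v⟩ = f(v)`. -/
def scalarKernel {X : Type*} (H : Type*) [NormedAddCommGroup H] [InnerProductSpace ℂ H]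
    [CompleteSpace H] [RKHS ℂ H X ℂ] (u v : X) : ℂ :=
  RKHS.kernel H u v 1

/-- The Hilbert function space `H` on `𝔾ₙ` is the weighted Bergman space `𝔸^(μ)(𝔾ₙ)`, `μ > 0`:
* for `μ > 1`, the holomorphic functions in `L²(𝔾ₙ, dV_𝐬^(μ))`, with the `L²` norm;
* for `μ = 1`, the Hardy space of `𝔾ₙ`;
* for `0 < μ < 1`, the Hilbert space of holomorphic functions whose reproducing kernel at
  `(𝐬(z), 𝐬(w))` is the Schur series. -/
def IsWeightedBergmanSpace (n : ℕ) (μ : ℝ) (H : Type*) [NormedAddCommGroup H]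
    [InnerProductSpace ℂ H] [CompleteSpace H] [RKHS ℂ H (symPolydisc n) ℂ] : Prop :=
  (1 < μ →
    (∀ f : symPolydisc n → ℂ, (∃ h : H, ⇑h = f) ↔ IsHolomorphic f ∧ bergmanNormSq μ f < ∞) ∧
    ∀ h : H, ‖h‖ₑ ^ 2 = bergmanNormSq μ ⇑h) ∧
  (μ = 1 →
    (∀ f : symPolydisc n → ℂ, (∃ h : H, ⇑h = f) ↔ IsHolomorphic f ∧ hardyNormSq f < ∞) ∧
    ∀ h : H, ‖h‖ₑ ^ 2 = hardyNormSq ⇑h) ∧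
  (μ < 1 →
    (∀ h : H, IsHolomorphic ⇑h) ∧
    ∀ z w : polydisc n, scalarKernel H (symMapOn n z) (symMapOn n w) = schurSeries μ z w)

/-! ### Normalized kernels -/

/-- The kernel `K` is normalized at `x₀`: `K(x, x₀) = 1` for all `x` near `x₀`. -/
def IsNormalizedAt {X : Type*} [TopologicalSpace X] (K : X → X → ℂ) (x₀ : X) : Prop :=
  ∀ᶠ x in 𝓝 x₀, K x x₀ = 1

/-- The normalization of the kernel `K` at `x₀`,
`K(x₀, x₀) K(x, x₀)⁻¹ K(x, y) K(x₀, y)⁻¹`, which is `φ(x) K(x, y) conj (φ(y))` for the function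
`φ(x) = K(x₀, x₀)^(1/2) K(x, x₀)⁻¹`. -/
def normalizedKernel {X : Type*} (K : X → X → ℂ) (x₀ : X) (x y : X) : ℂ :=
  K x₀ x₀ * (K x x₀)⁻¹ * K x y * (K x₀ y)⁻¹

/-! ### The determinants in the coordinates of the symmetrized polydisc -/

/-- The coordinates of `u = (u₁, …, uₙ)` extended to all integer indices: `u₀ = 1`, and `u_k = 0`
for `k < 0` and for `k > n`. -/
def coord {n : ℕ} (u : Fin n → ℂ) (k : ℤ) : ℂ :=
  if k = 0 then 1
  else if h : 1 ≤ k ∧ k ≤ n then u ⟨(k - 1).toNat, by omega⟩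
  else 0

/-- The length `r` of the conjugate partition `𝐩'`, which is the largest part of `𝐩`. -/
def conjLength {n : ℕ} (p : Parts n) : ℕ := Finset.univ.sup p.1

/-- The conjugate partition: with zero-based index `i`, the number of parts of `𝐩` that
are at least `i + 1`, which is the length of column `i + 1` of the Young diagram of `𝐩`. -/
def conjPart {n : ℕ} (p : Parts n) (i : ℕ) : ℕ := (Finset.univ.filter fun j => i + 1 ≤ p.1 j).card

/-- `det (u_{p'_i + j - i})_{i,j = 1}^r`. -/
def giambelliDet {n : ℕ} (p : Parts n) (u : Fin n → ℂ) : ℂ :=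
  (Matrix.of fun i j : Fin (conjLength p) =>
    coord u ((conjPart p i : ℤ) + ((j : ℕ) : ℤ) - ((i : ℕ) : ℤ))).det

end

end SymmetrizedPolydisc

namespace SymmetrizedPolydisc

open MeasureTheory Set Filter Topology
open scoped ENNReal ComplexConjugate

/-! ### The dual Jacobi–Trudi identity -/

/-! For holomorphic `f` on 𝔾ₙ, the function Δ·(f ∘ 𝐬) is antisymmetric and holomorphic on the
polydisc. Its power series has no monomial with a repeated exponent, and the remaining monomials
group into the alternants `a_{𝐩+δ}`. Dividing by Δ gives f ∘ 𝐬 = ∑ c_𝐩 S_𝐩 (`exists_eq_schurSum`).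
The dual Jacobi–Trudi identity (`eval_schur`) writes `S_𝐩` as a determinant in the coordinates of
𝔾ₙ.

Distinct monomials are orthogonal on every torus, hence for every rotation invariant weight. Each
`a_{𝐩+δ}` has n! monomials, all of squared norm (𝐩+δ)!/(μ)_{𝐩+δ} = 1/γ_𝐩² (which is 1 in the Hardy
case). After the factor 1/n!, both the Bergman and the Hardy norm become ∑ |c_𝐩|²/γ_𝐩²
(`IsSubexponential.bergmanNormSq_eq`, `IsSubexponential.hardyNormSq_eq`). So the γ_𝐩 S_𝐩 form an
orthonormal basis, and the kernel is ∑ γ_𝐩² S_𝐩(z) conj S_𝐩(w).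

The proof realizes this on ℓ²: a square summable family x is sent to ∑ x_𝐩 γ_𝐩 S_𝐩. Convergence and
holomorphy on 𝔾ₙ rest on the growth bound `exists_norm_giambelliDet_le`. This one model serves all μ
> 0 (`isWeightedBergmanSpace_schurSpace`). For μ ≥ 1 any other realization has the same functions
and norms, hence the same kernel (`scalarKernel_eq_of_norm_eq`); for μ < 1 the kernel is prescribed
and only existence is at stake.

At the origin every `S_𝐩` with 𝐩 ≠ 0 vanishes and S_0 = 1. Thus K(𝐬, 0) is the constant γ_0² =
(μ)_δ/δ!, and normalizing the kernel is division by this constant. -/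

theorem lt_part_iff_lt_conjPart {n : ℕ} (p : Parts n) (i : ℕ) (j : Fin n) :
    i < p.1 j ↔ (j : ℕ) < conjPart p i := by
  constructor
  · intro h
    have hsub : Finset.Iic j ⊆ Finset.univ.filter fun k => i + 1 ≤ p.1 k := by
      intro k hk
      simp only [Finset.mem_filter, Finset.mem_univ, true_and]
      exact h.trans_le (p.2 (Finset.mem_Iic.mp hk))
    have := Finset.card_le_card hsub
    rw [Fin.card_Iic] at this
    exact this
  · intro h
    by_contra hlt
    have hsub : (Finset.univ.filter fun k => i + 1 ≤ p.1 k) ⊆ Finset.Iio j := by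
      intro k hk
      simp only [Finset.mem_filter, Finset.mem_univ, true_and] at hk
      rw [Finset.mem_Iio]
      by_contra hjk
      have := p.2 (not_lt.mp hjk)
      omega
    have := Finset.card_le_card hsub
    rw [Fin.card_Iio] at this
    unfold conjPart at h
    omega

theorem conjPart_le {n : ℕ} (p : Parts n) (i : ℕ) : conjPart p i ≤ n :=
  (Finset.card_le_univ _).trans_eq (Fintype.card_fin n)

theorem conjPart_anti {n : ℕ} (p : Parts n) : Antitone (conjPart p) := by
  intro i j hij
  refine Finset.card_le_card fun k hk => ?_
  simp only [Finset.mem_filter, Finset.mem_univ, true_and] at hk ⊢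
  omega

theorem part_le_conjLength {n : ℕ} (p : Parts n) (j : Fin n) : p.1 j ≤ conjLength p :=
  Finset.le_sup (f := p.1) (Finset.mem_univ j)

/-- The exponents of the alternant of `𝐩 + δ` in increasing order, followed by their complement
in `{0, …, n + r - 1}`. -/
def exponentMap {n : ℕ} (p : Parts n) : Fin n ⊕ Fin (conjLength p) → Fin (n + conjLength p)
  | Sum.inl l => ⟨p.1 l.rev + l, by have := part_le_conjLength p l.rev; omega⟩
  | Sum.inr i => ⟨n + i - conjPart p i, by omega⟩

/-- If the part of index n-1-l is at most i, then p'_i ≤ n-1-l, and the two exponents are at most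
i+l and at least i+l+1. Otherwise p'_i ≥ n-l, and they are at least i+l+1 and at most i+l. -/
theorem exponentMap_inl_lt_inr {n : ℕ} (p : Parts n) (l : Fin n) (i : Fin (conjLength p)) :
    (exponentMap p (Sum.inl l) < exponentMap p (Sum.inr i) ↔ p.1 l.rev ≤ i) ∧
      exponentMap p (Sum.inl l) ≠ exponentMap p (Sum.inr i) := by
  have h := lt_part_iff_lt_conjPart p i l.rev
  have hle := conjPart_le p i
  rw [Fin.val_rev] at h
  simp only [exponentMap, Fin.lt_def, ne_eq, Fin.ext_iff]
  have := l.2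
  constructor <;> omega

theorem exponentMap_inl_lt {n : ℕ} (p : Parts n) {l k : Fin n} (h : l < k) :
    exponentMap p (Sum.inl l) < exponentMap p (Sum.inl k) := by
  have : p.1 l.rev ≤ p.1 k.rev := p.2 (Fin.rev_le_rev.mpr h.le)
  simp only [exponentMap, Fin.lt_def] at h ⊢
  omega

theorem exponentMap_inr_lt {n : ℕ} (p : Parts n) {i k : Fin (conjLength p)} (h : i < k) :
    exponentMap p (Sum.inr i) < exponentMap p (Sum.inr k) := by
  have : conjPart p k ≤ conjPart p i := conjPart_anti p (Fin.le_def.mp h.le)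
  have := conjPart_le p i
  simp only [exponentMap, Fin.lt_def] at h ⊢
  omega

theorem exponentMap_injective {n : ℕ} (p : Parts n) : Function.Injective (exponentMap p) := by
  rintro (a | a) (b | b) h
  · rcases lt_trichotomy a b with hab | hab | hab
    · exact absurd h (exponentMap_inl_lt p hab).ne
    · rw [hab]
    · exact absurd h (exponentMap_inl_lt p hab).ne'
  · exact absurd h (exponentMap_inl_lt_inr p a b).2
  · exact absurd h.symm (exponentMap_inl_lt_inr p b a).2
  · rcases lt_trichotomy a b with hab | hab | hab
    · exact absurd h (exponentMap_inr_lt p hab).ne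
    · rw [hab]
    · exact absurd h (exponentMap_inr_lt p hab).ne'

/-- `exponentMap` as a bijection. -/
noncomputable def exponentEquiv {n : ℕ} (p : Parts n) :
    Fin n ⊕ Fin (conjLength p) ≃ Fin (n + conjLength p) :=
  Equiv.ofBijective (exponentMap p)
    ((Fintype.bijective_iff_injective_and_card _).mpr ⟨exponentMap_injective p, by simp⟩)

/-- Both halves of the map are increasing, so an inversion pairs an exponent of 𝐩 + δ with a smaller
complementary one. The complementary exponent of index i takes part in one inversion for each part
of 𝐩 exceeding i, that is, in p'_i of them. -/
theorem sign_exponentEquiv {n : ℕ} (p : Parts n) :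
    Equiv.Perm.sign (finSumFinEquiv.symm.trans (exponentEquiv p)) =
      ∏ i : Fin (conjLength p), (-1) ^ conjPart p i := by
  rw [Equiv.Perm.sign_eq_prod_prod_Iio, Fin.prod_univ_add]
  have hl : ∀ l : Fin n, (finSumFinEquiv.symm.trans (exponentEquiv p))
      (Fin.castAdd (conjLength p) l) = exponentMap p (Sum.inl l) := by
    intro l; simp [exponentEquiv]
  have hr : ∀ i : Fin (conjLength p), (finSumFinEquiv.symm.trans (exponentEquiv p))
      (Fin.natAdd n i) = exponentMap p (Sum.inr i) := by
    intro l; simp [exponentEquiv]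
  have hIio : ∀ j : Fin (n + conjLength p), Finset.Iio j = Finset.univ.filter (· < j) := by
    intro j; ext; simp
  rw [Finset.prod_eq_one, one_mul]
  · refine Finset.prod_congr rfl fun k _ => ?_
    rw [hIio, Finset.prod_filter, Fin.prod_univ_add, mul_comm, Finset.prod_eq_one, one_mul]
    · have hk : ∀ l : Fin n, Fin.castAdd (conjLength p) l < Fin.natAdd n k := by
        intro l; simp only [Fin.lt_def, Fin.val_castAdd, Fin.val_natAdd]; omega
      simp only [hk, if_true, hl, hr, exponentMap_inl_lt_inr]
      rw [← Equiv.prod_comp Fin.revPerm]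
      simp only [Fin.revPerm_apply, Fin.rev_rev]
      rw [Finset.prod_ite, Finset.prod_const_one, one_mul, Finset.prod_const]
      congr 1
      unfold conjPart
      congr 1
      ext j
      simp
    · intro i _
      split_ifs with h1 h2
      · rfl
      · rw [hr, hr] at h2
        exact absurd (exponentMap_inr_lt p (by simpa using h1)) h2
      · rfl
  · intro l _
    refine Finset.prod_eq_one fun j hj => ?_
    rw [Finset.mem_Iio] at hj
    obtain ⟨m, rfl⟩ : ∃ m : Fin n, j = Fin.castAdd _ m :=
      ⟨⟨j, by have := Fin.lt_def.mp hj; simp only [Fin.val_castAdd] at this; omega⟩, rfl⟩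
    rw [hl, hl, if_pos (exponentMap_inl_lt p (Fin.lt_def.mpr (Fin.lt_def.mp hj)))]

/-- Vieta's formulas. The conventions for `coord` at 0, below 0 and above n match the leading and
the vanishing coefficients, so no condition on k and c is needed. -/
theorem coeff_prod_X_sub_C_eq_coord {n : ℕ} (z : Fin n → ℂ) (k c : ℕ) :
    (Polynomial.X ^ k * ∏ i, (Polynomial.X - Polynomial.C (z i))).coeff c =
      (-1) ^ (n + k + c) * coord (symMap z) ((n : ℤ) + k - c) := by
  have hmonic : (∏ i, (Polynomial.X - Polynomial.C (z i))).Monic :=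
    Polynomial.monic_prod_of_monic _ _ fun k _ => Polynomial.monic_X_sub_C _
  have hdeg : (∏ i, (Polynomial.X - Polynomial.C (z i))).natDegree = n := by
    simp [Polynomial.natDegree_prod_of_monic _ _ fun k _ => Polynomial.monic_X_sub_C (z k)]
  rw [Polynomial.coeff_X_pow_mul']
  split_ifs with hkc
  · obtain ⟨d, rfl⟩ := Nat.exists_eq_add_of_le hkc
    rw [Nat.add_sub_cancel_left]
    have hsign : (-1 : ℂ) ^ (n + k + (k + d)) = (-1) ^ (n + d) := by
      rw [show n + k + (k + d) = (n + d) + 2 * k by ring, pow_add, pow_mul]; simp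
    rw [hsign, show ((n : ℤ) + k - ((k + d : ℕ) : ℤ)) = n - d by push_cast; ring]
    rcases lt_trichotomy d n with hd | hd | hd
    · have hco := Multiset.prod_X_sub_C_coeff (Multiset.map z Finset.univ.val) (k := d)
        (by simpa using hd.le)
      rw [Multiset.map_map] at hco
      simp only [Multiset.card_map, Finset.card_val, Finset.card_univ, Fintype.card_fin,
        Finset.esymm_map_val] at hco
      rw [show (∏ i, (Polynomial.X - Polynomial.C (z i))) = (Multiset.map
        ((fun t => Polynomial.X - Polynomial.C t) ∘ z) Finset.univ.val).prod from rfl, hco]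
      have hs : (-1 : ℂ) ^ (n - d) = (-1) ^ (n + d) := by
        rw [show n + d = (n - d) + 2 * d by omega, pow_add, pow_mul]; simp
      rw [hs]
      congr 1
      unfold coord
      rw [if_neg (by omega), dif_pos (by omega)]
      simp only [symMap]
      congr 2
      omega
    · subst hd
      have hone : (-1 : ℂ) ^ (d + d) = 1 := by rw [← two_mul, pow_mul]; simp
      rw [hone, sub_self]
      have := hmonic.coeff_natDegree
      rw [hdeg] at this
      simp [this, coord]
    · rw [Polynomial.coeff_eq_zero_of_natDegree_lt (by omega)]
      unfold coord
      rw [if_neg (by omega), dif_neg (by omega), mul_zero]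
  · unfold coord
    rw [if_neg (by omega), dif_neg (by omega), mul_zero]

theorem eval_alternant {n : ℕ} (m : Fin n → ℕ) (z : Fin n → ℂ) :
    MvPolynomial.eval z (alternant m) = (Matrix.of fun i j : Fin n => z i ^ m j).det := by
  rw [alternant, RingHom.map_det]
  congr 1
  ext i j
  simp

theorem eval_alternant_rev {n : ℕ} (m : Fin n → ℕ) (z : Fin n → ℂ) :
    MvPolynomial.eval z (alternant m) = (Equiv.Perm.sign (Fin.revPerm (n := n)) : ℂ) *
      (Matrix.of fun i j : Fin n => z i ^ m j.rev).det := by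
  have := Matrix.det_permute' Fin.revPerm (Matrix.of fun i j : Fin n => z i ^ m j.rev)
  rw [← this, eval_alternant]
  congr 1
  ext i j
  simp

theorem eval_alternant_delta {n : ℕ} (z : Fin n → ℂ) :
    MvPolynomial.eval z (alternant (delta n)) =
      (Equiv.Perm.sign (Fin.revPerm (n := n)) : ℂ) * (Matrix.vandermonde z).det := by
  rw [eval_alternant_rev]
  congr 2
  ext i j
  simp only [Matrix.of_apply, Matrix.vandermonde_apply, delta, Fin.val_rev]
  congr 1
  omega

/-- `Δ` is the alternant of `δ`. -/
theorem jac_eq_alternant {n : ℕ} (z : Fin n → ℂ) :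
    jac z = MvPolynomial.eval z (alternant (delta n)) := by
  rw [eval_alternant]
  have h1 : (Matrix.of fun i j : Fin n => z i ^ delta n j).det =
      (Matrix.vandermonde fun i => z (Fin.rev i)).det := by
    rw [← Matrix.det_submatrix_equiv_self Fin.revPerm]
    congr 1
    ext i j
    simp only [Matrix.submatrix_apply, Matrix.of_apply, Matrix.vandermonde_apply, delta,
      Fin.revPerm_apply, Fin.val_rev]
    congr 1
    omega
  rw [h1, Matrix.det_vandermonde, jac, Finset.prod_sigma', Finset.prod_sigma']
  refine Finset.prod_bij' (fun x _ => ⟨x.2.rev, x.1.rev⟩) (fun x _ => ⟨x.2.rev, x.1.rev⟩)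
    ?_ ?_ ?_ ?_ ?_ <;> simp

/-- With P = ∏ (X - z_i), evaluate det (W Q) in two ways. The rows of W evaluate a coefficient
vector at the z_i or read off its coefficients of index n+b; the columns of Q are the monomials with
exponents in 𝐩 + δ and the polynomials X^k P. As X^k P vanishes at the z_i, W Q is block triangular
with the alternant and a unitriangular block on the diagonal. Separately, det W is the Vandermonde
determinant and det Q is the Jacobi–Trudi determinant. -/
theorem eval_alternant_add_delta {n : ℕ} (p : Parts n) (z : Fin n → ℂ) :
    MvPolynomial.eval z (alternant (p.1 + delta n)) =
      MvPolynomial.eval z (alternant (delta n)) * giambelliDet p (symMap z) := by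
  set P : Polynomial ℂ := ∏ i, (Polynomial.X - Polynomial.C (z i)) with hP
  let W : Matrix (Fin n ⊕ Fin (conjLength p)) (Fin (n + conjLength p)) ℂ := Matrix.of fun a c =>
    Sum.elim (fun i => z i ^ (c : ℕ)) (fun b : Fin (conjLength p) => if (c : ℕ) = n + b then 1 else 0) a
  let Q : Matrix (Fin (n + conjLength p)) (Fin n ⊕ Fin (conjLength p)) ℂ := Matrix.of fun c b =>
    Sum.elim (fun l => if c = exponentMap p (Sum.inl l) then 1 else 0)
      (fun k : Fin (conjLength p) => (Polynomial.X ^ (k : ℕ) * P).coeff c) b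
  have hcoeff := coeff_prod_X_sub_C_eq_coord z
  rw [← hP] at hcoeff
  have hdeg : P.natDegree = n := by
    simp [hP, Polynomial.natDegree_prod_of_monic _ _ fun k _ => Polynomial.monic_X_sub_C (z k)]
  have hW : (W.submatrix id finSumFinEquiv).det = (Matrix.vandermonde z).det := by
    have : W.submatrix id finSumFinEquiv = Matrix.fromBlocks (Matrix.vandermonde z)
        (Matrix.of fun i (b : Fin (conjLength p)) => z i ^ (n + b : ℕ)) 0 1 := by
      ext (i | i) (j | j)
      · simp [W]
      · simp [W]
      · have : (j : ℕ) ≠ n + i := by omega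
        simp [W, this]
      · simp [W, Matrix.one_apply, Fin.ext_iff, eq_comm]
    rw [this, Matrix.det_fromBlocks_zero₂₁, Matrix.det_one, mul_one]
  -- With the rows of 𝐩 + δ put first, Q is block triangular, and its lower block has entries
  -- (-1)^(p'_i+i+k) e_{p'_i+k-i}. The row signs (-1)^i cancel against the column signs (-1)^k,
  -- leaving ∏ (-1)^(p'_i).
  have hQ : (Q.submatrix (exponentEquiv p) id).det =
      (∏ i : Fin (conjLength p), (-1) ^ conjPart p i) * giambelliDet p (symMap z) := by
    have : Q.submatrix (exponentEquiv p) id = Matrix.fromBlocks 1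
        (Matrix.of fun l (k : Fin (conjLength p)) => (Polynomial.X ^ (k : ℕ) * P).coeff
          (exponentMap p (Sum.inl l)))
        0 (Matrix.of fun i k : Fin (conjLength p) => ((-1) ^ (conjPart p i + i : ℕ) : ℂ) *
          (Matrix.of fun i k : Fin (conjLength p) => (-1) ^ (k : ℕ) * (Matrix.of fun i k : Fin (conjLength p) =>
            coord (symMap z) ((conjPart p i : ℤ) + ((k : ℕ) : ℤ) - ((i : ℕ) : ℤ))) i k) i k) := by
      ext (i | i) (j | j)
      · simp [Q, exponentEquiv, Matrix.one_apply, (exponentMap_injective p).eq_iff]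
      · simp [Q, exponentEquiv]
      · simp [Q, exponentEquiv, (exponentMap_injective p).eq_iff]
      · simp only [Q, exponentEquiv, Matrix.submatrix_apply, Matrix.of_apply,
          Equiv.ofBijective_apply, id, Sum.elim_inr, Matrix.fromBlocks_apply₂₂, hcoeff]
        have hle := conjPart_le p i
        have hv : ((exponentMap p (Sum.inr i) : Fin (n + conjLength p)) : ℕ) = n + i - conjPart p i := rfl
        rw [hv, ← mul_assoc, ← pow_add]
        congr 1
        · have h2 : n + j + (n + i - conjPart p i) + 2 * conjPart p i =
              (conjPart p i + i + j) + 2 * n := by omega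
          have := congrArg (fun t => (-1 : ℂ) ^ t) h2
          simpa [pow_add, pow_mul] using this
        · congr 1
          omega
    rw [this, Matrix.det_fromBlocks_zero₂₁, Matrix.det_one, one_mul, Matrix.det_mul_column,
      Matrix.det_mul_row, ← mul_assoc, ← Finset.prod_mul_distrib]
    congr 1
    refine Finset.prod_congr rfl fun i _ => ?_
    rw [← pow_add, add_assoc, ← two_mul, pow_add, pow_mul]
    simp
  -- Restoring the natural order of the rows costs the sign of `exponentEquiv`, which is the same
  -- product, so both signs disappear.
  have hQ' : (Q.submatrix finSumFinEquiv id).det = giambelliDet p (symMap z) := by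
    have h1 : Q.submatrix finSumFinEquiv id = (Q.submatrix (exponentEquiv p) id).submatrix
        (finSumFinEquiv.trans (exponentEquiv p).symm) id := by
      ext a b; simp
    rw [h1, Matrix.det_permute, hQ]
    have h2 : Equiv.Perm.sign (finSumFinEquiv.trans (exponentEquiv p).symm) =
        Equiv.Perm.sign (finSumFinEquiv.symm.trans (exponentEquiv p)) := by
      rw [← Equiv.Perm.sign_symm_trans_trans (finSumFinEquiv.trans (exponentEquiv p).symm)
        finSumFinEquiv, ← Equiv.Perm.sign_inv]
      congr 1
      ext x
      simp [Equiv.Perm.inv_def]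
    rw [h2, sign_exponentEquiv, ← mul_assoc]
    push_cast
    rw [← Finset.prod_mul_distrib, Finset.prod_eq_one, one_mul]
    intro i _
    rw [← mul_pow]; simp
  have hWQ : W * Q = Matrix.fromBlocks
      (Matrix.of fun i l => z i ^ (p.1 (Fin.rev l) + l : ℕ)) 0
      (Matrix.of fun (b : Fin (conjLength p)) l => if ((exponentMap p (Sum.inl l) : Fin (n + conjLength p)) : ℕ) = n + b then 1 else 0)
      (Matrix.of fun b k : Fin (conjLength p) => (Polynomial.X ^ (k : ℕ) * P).coeff (n + b)) := by
    have hin : ∀ (k : Fin (conjLength p)) , (Polynomial.X ^ (k : ℕ) * P).natDegree < n + conjLength p := by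
      intro k
      refine (Polynomial.natDegree_mul_le).trans_lt ?_
      simp only [Polynomial.natDegree_X_pow, hdeg]
      omega
    ext (i | i) (j | j)
    · simp only [Matrix.mul_apply, W, Q, Matrix.of_apply, Sum.elim_inl, mul_ite, mul_one, mul_zero,
        Finset.sum_ite_eq', Finset.mem_univ, if_true, Matrix.fromBlocks_apply₁₁]
      rfl
    · simp only [Matrix.mul_apply, W, Q, Matrix.of_apply, Sum.elim_inl, Sum.elim_inr,
        Matrix.fromBlocks_apply₁₂, Matrix.zero_apply]
      have heval := Polynomial.eval_eq_sum_range' (hin j) (z i)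
      rw [Finset.sum_range, Polynomial.eval_mul, hP, Polynomial.eval_prod,
        Finset.prod_eq_zero (Finset.mem_univ i) (by simp), mul_zero, ← hP] at heval
      exact (Finset.sum_congr rfl fun c _ => mul_comm _ _).trans heval.symm
    · simp [Matrix.mul_apply, W, Q]
    · simp only [Matrix.mul_apply, W, Q, Matrix.of_apply, Sum.elim_inr,
        Matrix.fromBlocks_apply₂₂]
      rw [Finset.sum_eq_single (Fin.natAdd n i)]
      · simp
      · intro c _ hc
        rw [if_neg, zero_mul]
        simpa [Fin.ext_iff] using hc
      · simp
  have hT : (Matrix.of fun b k : Fin (conjLength p) => (Polynomial.X ^ (k : ℕ) * P).coeff (n + b)).det = 1 := by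
    rw [Matrix.det_of_isUpperTriangular]
    · refine Finset.prod_eq_one fun i _ => ?_
      simp only [Matrix.of_apply, hcoeff]
      rw [show n + (i : ℕ) + (n + i) = 2 * (n + i) by ring, pow_mul]
      simp [coord]
    · intro i j hij
      have hij' : (j : ℕ) < i := hij
      simp only [Matrix.of_apply, hcoeff]
      unfold coord
      rw [if_neg (by push_cast; omega), dif_neg (by push_cast; omega), mul_zero]
  have hdet : (W * Q).det = (Matrix.vandermonde z).det * giambelliDet p (symMap z) := by
    have := Matrix.submatrix_mul_equiv W Q id finSumFinEquiv id
    rw [Matrix.submatrix_id_id] at this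
    rw [← this, Matrix.det_mul, hW, hQ']
  rw [hWQ, Matrix.det_fromBlocks_zero₁₂, hT, mul_one] at hdet
  rw [eval_alternant_delta, eval_alternant_rev, mul_assoc, ← hdet]
  congr 3
  ext i l
  simp only [Pi.add_apply, delta, Fin.val_rev]
  congr 1
  omega

theorem continuous_symMap {n : ℕ} : Continuous (symMap (n := n)) := by
  unfold symMap
  fun_prop

theorem continuous_coord {n : ℕ} (k : ℤ) : Continuous fun u : Fin n → ℂ => coord u k := by
  unfold coord
  split_ifs <;> fun_prop

theorem continuous_giambelliDet {n : ℕ} (p : Parts n) : Continuous (giambelliDet p) := by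
  unfold giambelliDet
  exact Continuous.matrix_det (continuous_matrix fun i j => continuous_coord _)

theorem continuous_jac {n : ℕ} : Continuous (jac (n := n)) := by
  unfold jac
  fun_prop

theorem jac_ne_zero_iff {n : ℕ} (z : Fin n → ℂ) : jac z ≠ 0 ↔ Function.Injective z := by
  simp only [jac, ne_eq, Finset.prod_eq_zero_iff, Finset.mem_univ, true_and, Finset.mem_Ioi,
    not_exists, not_and, sub_eq_zero]
  constructor
  · intro h i j hij
    rcases lt_trichotomy i j with hlt | heq | hgt
    · exact absurd hij (h i j hlt)
    · exact heq
    · exact absurd hij.symm (h j i hgt)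
  · intro h i j hlt heq
    exact hlt.ne (h heq)

/-- On the complex line through z in the direction (0, 1, 2, …), any two coordinates coincide for at
most one parameter, so Δ vanishes at only finitely many points of it. -/
theorem dense_jac_ne_zero (n : ℕ) : Dense {z : Fin n → ℂ | jac z ≠ 0} := by
  intro z
  let v : ℂ → Fin n → ℂ := fun t j => z j + t * (j : ℂ)
  have hv : Continuous v := by fun_prop
  have hfin : {t : ℂ | jac (v t) = 0}.Finite := by
    refine (Set.finite_range fun ij : Fin n × Fin n =>
      (z ij.2 - z ij.1) / ((ij.1 : ℂ) - (ij.2 : ℂ))).subset fun t ht => ?_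
    have : ¬ Function.Injective (v t) := fun h => (jac_ne_zero_iff _).mpr h ht
    simp only [Function.Injective, not_forall] at this
    obtain ⟨i, j, hij, hne⟩ := this
    refine ⟨(i, j), ?_⟩
    have hne' : (i : ℂ) - (j : ℂ) ≠ 0 := by
      rw [sub_ne_zero]
      exact fun h => hne (Fin.ext (by exact_mod_cast h))
    simp only [v] at hij
    rw [div_eq_iff hne']
    linear_combination -hij
  have hd := hfin.countable.dense_compl ℂ (0 : ℂ)
  have h0 : v 0 = z := by funext j; simp [v]
  rw [← h0]
  exact map_mem_closure hv hd fun t ht => ht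

/-- The dual Jacobi–Trudi identity. -/
theorem eval_schur {n : ℕ} (p : Parts n) (z : Fin n → ℂ) :
    MvPolynomial.eval z (schur p) = giambelliDet p (symMap z) := by
  have h : (fun z : Fin n → ℂ => MvPolynomial.eval z (schur p)) =
      fun z => giambelliDet p (symMap z) := by
    -- Δ can be cancelled only where it is nonzero; both sides are continuous, so density gives the
    -- rest.
    refine Continuous.ext_on (dense_jac_ne_zero n) (MvPolynomial.continuous_eval _)
      ((continuous_giambelliDet p).comp continuous_symMap) fun w hw => ?_
    have h1 : alternant (p.1 + delta n) = alternant (delta n) * schur p :=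
      (alternant_delta_dvd (p.1 + delta n)).choose_spec
    have h2 := eval_alternant_add_delta p w
    rw [h1, map_mul, ← jac_eq_alternant] at h2
    exact mul_left_cancel₀ hw h2
  exact congrFun h z

/-- `a_{𝐩 + δ} = Δ · S_𝐩`, in the coordinates of the symmetrized polydisc. -/
theorem jac_mul_giambelliDet {n : ℕ} (p : Parts n) (z : Fin n → ℂ) :
    jac z * giambelliDet p (symMap z) = MvPolynomial.eval z (alternant (p.1 + delta n)) := by
  rw [eval_alternant_add_delta, jac_eq_alternant]

/-! ### Holomorphic functions of several variables -/

theorem hasSum_prod_pi {𝕜 : Type*} [NormedField 𝕜] [CompleteSpace 𝕜] {n : ℕ}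
    {f : Fin n → ℕ → 𝕜} {a : Fin n → 𝕜} (hs : ∀ i, Summable fun k => ‖f i k‖)
    (hf : ∀ i, HasSum (f i) (a i)) :
    HasSum (fun m : Fin n → ℕ => ∏ i, f i (m i)) (∏ i, a i) ∧
      Summable fun m : Fin n → ℕ => ‖∏ i, f i (m i)‖ := by
  induction n with
  | zero =>
    simp only [Finset.univ_eq_empty, Finset.prod_empty]
    exact ⟨hasSum_unique (fun _ : Fin 0 → ℕ => (1 : 𝕜)), (hasSum_unique _).summable⟩
  | succ n ih =>
    obtain ⟨h1, h2⟩ := ih (fun i => hs i.succ) (fun i => hf i.succ)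
    have hsum := summable_mul_of_summable_norm (hs 0) h2
    have hnorm := (hs 0).mul_norm h2
    have h3 := (hf 0).mul h1 hsum
    rw [Fin.prod_univ_succ]
    constructor
    · rw [← (Fin.consEquiv fun _ => ℕ).hasSum_iff]
      refine h3.congr_fun fun x => ?_
      simp [Fin.prod_univ_succ, Fin.consEquiv]
    · rw [← (Fin.consEquiv fun _ => ℕ).summable_iff]
      refine hnorm.congr fun x => ?_
      simp [Fin.prod_univ_succ, Fin.consEquiv]

theorem torusMap_zero_apply {n : ℕ} (ρ : ℝ) (θ : Fin n → ℝ) (i : Fin n) :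
    torusMap 0 (fun _ => ρ) θ i = ρ * Complex.exp (θ i * Complex.I) := by
  simp [torusMap]

theorem norm_torusMap_zero {n : ℕ} {ρ : ℝ} (hρ : 0 ≤ ρ) (θ : Fin n → ℝ) (i : Fin n) :
    ‖torusMap 0 (fun _ => ρ) θ i‖ = ρ := by
  rw [torusMap_zero_apply, norm_mul, Complex.norm_exp_ofReal_mul_I, mul_one, Complex.norm_real,
    Real.norm_of_nonneg hρ]

theorem continuous_torusMap {n : ℕ} (ρ : ℝ) :
    Continuous (torusMap (0 : Fin n → ℂ) fun _ => ρ) := by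
  unfold torusMap
  fun_prop

theorem differentiableOn_cons {n : ℕ} {F : (Fin (n + 1) → ℂ) → ℂ}
    (hF : DifferentiableOn ℂ F (polydisc (n + 1))) {x : ℂ} (hx : ‖x‖ < 1) :
    DifferentiableOn ℂ (fun y : Fin n → ℂ => F (Fin.cons x y)) (polydisc n) := by
  refine hF.comp (t := polydisc (n + 1)) (f := fun y : Fin n → ℂ => (Fin.cons x y : Fin (n + 1) → ℂ)) ?_ ?_
  · refine Differentiable.differentiableOn (differentiable_pi.mpr fun i => ?_)
    refine Fin.cases ?_ (fun j => ?_) i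
    · simp
    · simp only [Fin.cons_succ]; fun_prop
  · intro y hy i
    refine Fin.cases ?_ (fun j => ?_) i
    · simpa using hx
    · simpa using hy j

/-- The Cauchy integral formula on a polydisc. -/
theorem torusIntegral_sub_inv_mul {n : ℕ} {F : (Fin n → ℂ) → ℂ}
    (hF : DifferentiableOn ℂ F (polydisc n)) {ρ : ℝ} (hρ0 : 0 < ρ) (hρ : ρ < 1)
    {w : Fin n → ℂ} (hw : ∀ i, ‖w i‖ < ρ) :
    (∯ ζ in T(0, fun _ => ρ), (∏ i, (ζ i - w i)⁻¹) * F ζ) =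
      (2 * Real.pi * Complex.I) ^ n * F w := by
  induction n with
  | zero =>
    rw [torusIntegral_dim0]
    simp [Subsingleton.elim (0 : Fin 0 → ℂ) w]
  | succ n ih =>
    have hint : TorusIntegrable (fun ζ => (∏ i, (ζ i - w i)⁻¹) * F ζ) 0 (fun _ => ρ) := by
      refine ContinuousOn.integrableOn_compact isCompact_Icc (Continuous.continuousOn ?_)
      refine Continuous.mul ?_ ?_
      · refine continuous_finsetProd _ fun i _ => ?_
        refine Continuous.inv₀ (((continuous_apply i).comp (continuous_torusMap ρ)).sub
          continuous_const) fun θ h => ?_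
        have h1 := norm_torusMap_zero hρ0.le θ i
        rw [sub_eq_zero.mp h] at h1
        exact (hw i).ne h1
      · exact hF.continuousOn.comp_continuous (continuous_torusMap ρ) fun θ i => by
          rw [norm_torusMap_zero hρ0.le]; exact hρ
    rw [torusIntegral_succ hint]
    have hinner : ∀ x : ℂ, ‖x‖ = ρ → (∯ y in T((0 : Fin (n + 1) → ℂ) ∘ Fin.succ,
        (fun _ : Fin (n + 1) => ρ) ∘ Fin.succ),
        (∏ i, ((Fin.cons x y : Fin (n + 1) → ℂ) i - w i)⁻¹) * F (Fin.cons x y)) =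
        (2 * Real.pi * Complex.I) ^ n * ((x - w 0)⁻¹ • F (Fin.cons x (w ∘ Fin.succ))) := by
      intro x hx
      have := ih (differentiableOn_cons hF (hx.trans_lt hρ)) (w := w ∘ Fin.succ)
        (fun i => hw i.succ)
      rw [smul_eq_mul, mul_left_comm, ← this, ← torusIntegral_const_mul]
      refine congrArg (fun g => torusIntegral g _ _) (funext fun y => ?_)
      rw [Fin.prod_univ_succ]
      simp [mul_assoc]
    rw [circleIntegral.integral_congr hρ0.le (g := fun x => (2 * Real.pi * Complex.I) ^ n *
      ((x - w 0)⁻¹ • F (Fin.cons x (w ∘ Fin.succ))))]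
    · have hd : DifferentiableOn ℂ (fun x : ℂ => F (Fin.cons x (w ∘ Fin.succ)))
          (Metric.ball 0 1) := by
        refine hF.comp (f := fun x : ℂ => (Fin.cons x (w ∘ Fin.succ) : Fin (n + 1) → ℂ)) ?_ ?_
        · refine Differentiable.differentiableOn (differentiable_pi.mpr fun i => ?_)
          refine Fin.cases ?_ (fun j => ?_) i
          · simp only [Fin.cons_zero]; fun_prop
          · simp
        · intro x hx i
          refine Fin.cases ?_ (fun j => ?_) i
          · simpa using hx
          · simpa using (hw j.succ).trans hρ
      have hcl : DiffContOnCl ℂ (fun x : ℂ => F (Fin.cons x (w ∘ Fin.succ)))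
          (Metric.ball 0 ρ) := by
        refine DifferentiableOn.diffContOnCl (hd.mono ?_)
        rw [closure_ball _ hρ0.ne']
        exact Metric.closedBall_subset_ball hρ
      rw [circleIntegral.integral_const_mul]
      have := hcl.circleIntegral_sub_inv_smul (w := w 0) (by simpa using hw 0)
      have hcons : (Fin.cons (w 0) (w ∘ Fin.succ) : Fin (n + 1) → ℂ) = w := Fin.cons_self_tail w
      rw [Pi.zero_apply, this, pow_succ, smul_eq_mul, ← mul_assoc, hcons]
    · intro x hx
      exact hinner x (by simpa using hx)

/-- Each factor 1/(ζ_i - w_i) of the Cauchy kernel is expanded in a geometric series, and the sum is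
exchanged with the torus integral by dominated convergence. -/
theorem exists_hasSum_of_differentiableOn {n : ℕ} {F : (Fin n → ℂ) → ℂ}
    (hF : DifferentiableOn ℂ F (polydisc n)) {ρ : ℝ} (hρ0 : 0 < ρ) (hρ : ρ < 1) :
    ∃ c : (Fin n → ℕ) → ℂ, ∀ w : Fin n → ℂ, (∀ i, ‖w i‖ < ρ) →
      HasSum (fun m => c m * ∏ i, w i ^ m i) (F w) := by
  have hcont : Continuous fun θ => F (torusMap 0 (fun _ => ρ) θ) :=
    hF.continuousOn.comp_continuous (continuous_torusMap ρ) fun θ i => by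
      rw [norm_torusMap_zero hρ0.le]; exact hρ
  have hne : ∀ (θ : Fin n → ℝ) i, torusMap 0 (fun _ => ρ) θ i ≠ 0 := fun θ i h => by
    have := norm_torusMap_zero hρ0.le θ i
    rw [h, norm_zero] at this
    exact hρ0.ne this
  obtain ⟨M, hM⟩ := (isCompact_Icc (a := (0 : Fin n → ℝ)) (b := fun _ => 2 * Real.pi)).exists_bound_of_continuousOn
    hcont.continuousOn
  have h2 : (2 * Real.pi * Complex.I : ℂ) ^ n ≠ 0 := pow_ne_zero _ Complex.two_pi_I_ne_zero
  refine ⟨fun m => ((2 * Real.pi * Complex.I) ^ n)⁻¹ *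
    ∯ ζ in T(0, fun _ => ρ), (∏ i, (ζ i ^ (m i + 1))⁻¹) * F ζ, fun w hw => ?_⟩
  have key : HasSum (fun m : Fin n → ℕ => ∯ ζ in T(0, fun _ => ρ),
      (∏ i, w i ^ m i * (ζ i ^ (m i + 1))⁻¹) * F ζ)
      (∯ ζ in T(0, fun _ => ρ), (∏ i, (ζ i - w i)⁻¹) * F ζ) := by
    have hgeo : ∀ i, HasSum (fun k : ℕ => ‖w i‖ ^ k * (ρ ^ (k + 1))⁻¹) (ρ - ‖w i‖)⁻¹ := by
      intro i
      have h := (hasSum_geometric_of_lt_one (r := ‖w i‖ / ρ) (by positivity)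
        ((div_lt_one hρ0).mpr (hw i))).mul_left ρ⁻¹
      rw [← mul_inv, mul_sub, mul_one, mul_div_cancel₀ _ hρ0.ne'] at h
      refine h.congr_fun fun k => ?_
      rw [div_pow, pow_succ]
      field_simp
    have hgs : ∀ i, Summable fun k : ℕ => ‖‖w i‖ ^ k * (ρ ^ (k + 1))⁻¹‖ := fun i =>
      (hgeo i).summable.norm
    obtain ⟨hb1, hb2⟩ := hasSum_prod_pi hgs hgeo
    refine hasSum_integral_of_dominated_convergence
      -- The factor ∏ ρ is the modulus of the Jacobian in the torus integral, and M bounds F on the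
      -- torus.
      (fun m _ => (∏ _i : Fin n, ρ) * ((∏ i, ‖w i‖ ^ m i * (ρ ^ (m i + 1))⁻¹) * M)) ?_ ?_ ?_ ?_ ?_
    · intro m
      refine Continuous.aestronglyMeasurable (Continuous.smul (f := fun θ : Fin n → ℝ => ∏ i : Fin n,
        (ρ : ℂ) * Complex.exp (θ i * Complex.I) * Complex.I) (by fun_prop) (Continuous.mul ?_ hcont))
      refine continuous_finsetProd _ fun i _ => continuous_const.mul
        (Continuous.inv₀ (((continuous_apply i).comp (continuous_torusMap ρ)).pow _)
          fun θ => pow_ne_zero _ (hne θ i))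
    · intro m
      filter_upwards [ae_restrict_mem measurableSet_Icc] with θ hθ
      rw [norm_smul, norm_mul, norm_prod, norm_prod]
      simp only [norm_mul, norm_inv, norm_pow, norm_torusMap_zero hρ0.le, Complex.norm_I,
        Complex.norm_exp_ofReal_mul_I, mul_one, Complex.norm_real, Real.norm_of_nonneg hρ0.le]
      gcongr
      exact hM θ hθ
    · exact ae_of_all _ fun θ => ((hb1.summable.mul_right M).mul_left _)
    · exact integrableOn_const isCompact_Icc.measure_ne_top
    · refine ae_of_all _ fun θ => ?_
      refine HasSum.const_smul _ (HasSum.mul_right _ (hasSum_prod_pi (n := n)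
        (f := fun i k => w i ^ k * (torusMap 0 (fun _ => ρ) θ i ^ (k + 1))⁻¹)
        (a := fun i => (torusMap 0 (fun _ => ρ) θ i - w i)⁻¹) ?_ ?_).1)
      · intro i
        refine (hgeo i).summable.congr fun k => ?_
        rw [norm_mul, norm_inv, norm_pow, norm_pow, norm_torusMap_zero hρ0.le]
      · intro i
        set ζ := torusMap 0 (fun _ => ρ) θ i with hζ
        have hζn : ‖ζ‖ = ρ := norm_torusMap_zero hρ0.le θ i
        have hζ0 : ζ ≠ 0 := hne θ i
        have h := (hasSum_geometric_of_norm_lt_one (ξ := w i / ζ)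
          (by rw [norm_div, hζn]; exact (div_lt_one hρ0).mpr (hw i))).mul_left ζ⁻¹
        rw [← mul_inv, mul_sub, mul_one, mul_div_cancel₀ _ hζ0] at h
        refine h.congr_fun fun k => ?_
        rw [div_pow, pow_succ]
        field_simp
  rw [torusIntegral_sub_inv_mul hF hρ0 hρ hw] at key
  have h := key.mul_left ((2 * Real.pi * Complex.I : ℂ) ^ n)⁻¹
  rw [inv_mul_cancel_left₀ h2] at h
  refine h.congr_fun fun m => ?_
  rw [mul_assoc]
  congr 1
  rw [mul_comm, ← torusIntegral_const_mul]
  refine congrArg (fun g => torusIntegral g _ _) (funext fun ζ => ?_)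
  rw [Finset.prod_mul_distrib, mul_assoc]

/-- The maximum principle on a closed polydisc with respect to its distinguished boundary. -/
theorem norm_le_of_forall_torus_norm_le {n : ℕ} {F : (Fin n → ℂ) → ℂ} (hF : Differentiable ℂ F)
    {ρ : Fin n → ℝ} (hρ : ∀ i, 0 < ρ i) {M : ℝ} (hM : ∀ z : Fin n → ℂ, (∀ i, ‖z i‖ = ρ i) → ‖F z‖ ≤ M)
    {z : Fin n → ℂ} (hz : ∀ i, ‖z i‖ ≤ ρ i) : ‖F z‖ ≤ M := by
  -- S is the set of coordinates allowed inside their discs while the others stay on their circles.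
  -- Enlarging S by one coordinate is the one-variable maximum principle.
  suffices H : ∀ S : Finset (Fin n), ∀ z : Fin n → ℂ, (∀ i ∈ S, ‖z i‖ ≤ ρ i) →
      (∀ i ∉ S, ‖z i‖ = ρ i) → ‖F z‖ ≤ M from
    H Finset.univ z (fun i _ => hz i) fun i hi => absurd (Finset.mem_univ i) hi
  intro S
  induction S using Finset.induction_on with
  | empty => exact fun z _ h => hM z fun i => h i (Finset.notMem_empty i)
  | insert a S ha ih =>
    intro z h1 h2
    have hd : Differentiable ℂ fun w : ℂ => F (Function.update z a w) := by
      refine hF.comp (differentiable_pi.mpr fun i => ?_)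
      by_cases hi : i = a
      · subst hi; simp
      · simp [Function.update_of_ne hi]
    have := Complex.norm_le_of_forall_mem_frontier_norm_le (Metric.isBounded_ball (x := (0 : ℂ)) (r := ρ a))
      hd.diffContOnCl (C := M) (z := z a) (fun w hw => ?_) ?_
    · simpa using this
    · rw [frontier_ball _ (hρ a).ne'] at hw
      refine ih _ (fun i hi => ?_) fun i hi => ?_
      · rw [Function.update_of_ne (by rintro rfl; exact ha hi)]
        exact h1 i (Finset.mem_insert_of_mem hi)
      · by_cases hia : i = a
        · subst hia; simpa using hw
        · rw [Function.update_of_ne hia]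
          exact h2 i (by simp [hia, hi])
    · rw [closure_ball _ (hρ a).ne']
      simpa using h1 a (Finset.mem_insert_self _ _)

/-- A series of holomorphic functions that is normally convergent on an open set has a
holomorphic sum. -/
theorem differentiableOn_tsum_of_norm_le {E ι : Type*} [NormedAddCommGroup E] [NormedSpace ℂ E]
    {U : Set E} (hU : IsOpen U) {f : ι → E → ℂ} {M : ι → ℝ} (hM : Summable M)
    (hf : ∀ p, DifferentiableOn ℂ (f p) U) (hfM : ∀ p, ∀ u ∈ U, ‖f p u‖ ≤ M p) :
    DifferentiableOn ℂ (fun u => ∑' p, f p u) U := by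
  intro u hu
  obtain ⟨r, hr0, hr⟩ := Metric.isOpen_iff.mp hU u hu
  refine DifferentiableAt.differentiableWithinAt ?_
  have hsub : ∀ x ∈ Metric.ball u (r / 2), Metric.ball x (r / 2) ⊆ U := fun x hx =>
    (Metric.ball_subset_ball' (by rw [Metric.mem_ball] at hx; linarith)).trans hr
  -- Cauchy's estimate on balls of radius r/2, which stay inside U; 2 M_p bounds the oscillation of
  -- `f p` there. This permits termwise differentiation.
  have hbound : ∀ p, ∀ x ∈ Metric.ball u (r / 2), ‖fderiv ℂ (f p) x‖ ≤ 2 * M p / (r / 2) := by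
    intro p x hx
    refine Complex.norm_fderiv_le_div_of_mapsTo_ball ((hf p).mono (hsub x hx)) ?_ (by positivity)
    intro y hy
    rw [Metric.mem_closedBall, dist_eq_norm]
    have h1 := hfM p y (hsub x hx hy)
    have h2 := hfM p x (hsub x hx (Metric.mem_ball_self (by positivity)))
    exact (norm_sub_le _ _).trans (by linarith)
  have hu' : u ∈ Metric.ball u (r / 2) := Metric.mem_ball_self (by positivity)
  refine (hasFDerivAt_tsum_of_isPreconnected (f' := fun p => fderiv ℂ (f p))
    ((hM.mul_left 2).div_const (r / 2)) Metric.isOpen_ball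
    ((convex_ball u (r / 2)).isPreconnected) (fun p x hx => ?_) hbound hu'
    (Summable.of_norm_bounded hM fun p => hfM p u hu) hu').differentiableAt
  exact ((hf p).differentiableAt (hU.mem_nhds (hsub x hx
    (Metric.mem_ball_self (by positivity))))).hasFDerivAt

/-! ### Parseval's identity on the torus -/

theorem integral_exp_pow_mul_conj (a b : ℕ) :
    ∫ θ in Icc (0 : ℝ) (2 * Real.pi),
      Complex.exp (θ * Complex.I) ^ a * conj (Complex.exp (θ * Complex.I) ^ b) =
      if a = b then ((2 * Real.pi : ℝ) : ℂ) else 0 := by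
  have h1 : ∀ θ : ℝ, Complex.exp (θ * Complex.I) ^ a * conj (Complex.exp (θ * Complex.I) ^ b) =
      Complex.exp ((((a : ℂ) - b) * Complex.I) * θ) := by
    intro θ
    rw [map_pow, ← Complex.exp_conj, ← Complex.exp_nat_mul, ← Complex.exp_nat_mul, ← Complex.exp_add]
    congr 1
    simp only [map_mul, Complex.conj_ofReal, Complex.conj_I]
    ring
  simp_rw [h1]
  rw [integral_Icc_eq_integral_Ioc, ← intervalIntegral.integral_of_le Real.two_pi_pos.le]
  split_ifs with hab
  · subst hab
    simp
  · have hne : ((a : ℂ) - b) * Complex.I ≠ 0 :=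
      mul_ne_zero (sub_ne_zero.mpr (by exact_mod_cast hab)) Complex.I_ne_zero
    rw [integral_exp_mul_complex hne]
    have h2 : Complex.exp (((a : ℂ) - b) * Complex.I * ((2 * Real.pi : ℝ) : ℂ)) = 1 := by
      rw [Complex.exp_eq_one_iff]
      exact ⟨(a : ℤ) - b, by push_cast; ring⟩
    rw [h2]
    simp

/-- The monomial characters of the torus. -/
noncomputable def torusChar {n : ℕ} (m : Fin n → ℕ) (θ : Fin n → ℝ) : ℂ :=
  ∏ j, Complex.exp (θ j * Complex.I) ^ m j

theorem norm_torusChar {n : ℕ} (m : Fin n → ℕ) (θ : Fin n → ℝ) : ‖torusChar m θ‖ = 1 := by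
  simp [torusChar, norm_prod, Complex.norm_exp_ofReal_mul_I]

theorem continuous_torusChar {n : ℕ} (m : Fin n → ℕ) : Continuous (torusChar m) := by
  unfold torusChar
  fun_prop

theorem integral_torusChar_mul_conj {n : ℕ} (m k : Fin n → ℕ) :
    ∫ θ in Icc (0 : Fin n → ℝ) (fun _ => 2 * Real.pi), torusChar m θ * conj (torusChar k θ) =
      if m = k then (((2 * Real.pi) ^ n : ℝ) : ℂ) else 0 := by
  have h1 : ∀ θ : Fin n → ℝ, torusChar m θ * conj (torusChar k θ) =
      ∏ j, (Complex.exp (θ j * Complex.I) ^ m j * conj (Complex.exp (θ j * Complex.I) ^ k j)) := by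
    intro θ
    rw [torusChar, torusChar, map_prod, Finset.prod_mul_distrib]
  simp_rw [h1]
  rw [← Set.pi_univ_Icc, volume_pi, Measure.restrict_pi_pi,
    integral_fintype_prod_eq_prod (𝕜 := ℂ) (fun j (x : ℝ) => Complex.exp (x * Complex.I) ^ m j *
      conj (Complex.exp (x * Complex.I) ^ k j))]
  simp only [Pi.zero_apply, integral_exp_pow_mul_conj]
  split_ifs with hmk
  · subst hmk
    simp
  · obtain ⟨j, hj⟩ := Function.ne_iff.mp hmk
    exact Finset.prod_eq_zero (Finset.mem_univ j) (if_neg hj)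

theorem continuous_tsum_torusChar {n : ℕ} {ι : Type*} (e : ι → Fin n → ℕ) {b : ι → ℂ}
    (hb : Summable fun i => ‖b i‖) : Continuous fun θ => ∑' i, b i * torusChar (e i) θ :=
  continuous_tsum (fun i => continuous_const.mul (continuous_torusChar _)) hb fun i θ => by
    rw [norm_mul, norm_torusChar, mul_one]

/-- Absolute summability allows |G|² to be expanded as a double series and integrated termwise.
Since `e` is injective, orthogonality of the characters leaves only the diagonal. -/
theorem lintegral_torus_enorm_sq {n : ℕ} {ι : Type*} {e : ι → Fin n → ℕ}
    (he : Function.Injective e) {b : ι → ℂ} (hb : Summable fun i => ‖b i‖) :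
    ∫⁻ θ in Icc (0 : Fin n → ℝ) (fun _ => 2 * Real.pi), ‖∑' i, b i * torusChar (e i) θ‖ₑ ^ 2 =
      ENNReal.ofReal ((2 * Real.pi) ^ n) * ∑' i, ‖b i‖ₑ ^ 2 := by
  have : Countable ι := he.countable
  set G : (Fin n → ℝ) → ℂ := fun θ => ∑' i, b i * torusChar (e i) θ with hG
  have hGc : Continuous G := continuous_tsum_torusChar e hb
  have hsum : ∀ θ, Summable fun i => ‖b i * torusChar (e i) θ‖ := fun θ => by
    simpa [norm_torusChar] using hb
  have hb2 : Summable fun x : ι × ι => ‖b x.1‖ * ‖b x.2‖ := by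
    simpa using hb.mul_norm hb
  have hGG : ∀ θ, ((‖G θ‖ ^ 2 : ℝ) : ℂ) = ∑' x : ι × ι, b x.1 * conj (b x.2) *
      (torusChar (e x.1) θ * conj (torusChar (e x.2) θ)) := by
    intro θ
    have hconj : conj (G θ) = ∑' i, conj (b i * torusChar (e i) θ) := Complex.conj_tsum _
    push_cast
    rw [← Complex.mul_conj', hconj, hG]
    have hs' : Summable fun i => ‖conj (b i * torusChar (e i) θ)‖ := by
      simpa only [RCLike.norm_conj] using hsum θ
    rw [tsum_mul_tsum_of_summable_norm (hsum θ) hs']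
    refine tsum_congr fun x => ?_
    rw [map_mul]
    ring
  have hint : ∀ x : ι × ι, Integrable (fun θ => b x.1 * conj (b x.2) *
      (torusChar (e x.1) θ * conj (torusChar (e x.2) θ)))
      (volume.restrict (Icc (0 : Fin n → ℝ) (fun _ => 2 * Real.pi))) := fun x =>
    (Continuous.continuousOn (continuous_const.mul ((continuous_torusChar _).mul
      (Complex.continuous_conj.comp (continuous_torusChar _))))).integrableOn_compact isCompact_Icc
  have hnorm : ∀ (x : ι × ι) θ, ‖b x.1 * conj (b x.2) *
      (torusChar (e x.1) θ * conj (torusChar (e x.2) θ))‖ = ‖b x.1‖ * ‖b x.2‖ := fun x θ => by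
    simp [norm_torusChar]
  have hHS := hasSum_integral_of_summable_integral_norm hint (by
    simp_rw [hnorm, integral_const]
    exact hb2.const_smul _)
  simp_rw [← hGG, integral_const_mul, integral_torusChar_mul_conj] at hHS
  have hdiag : HasSum (fun i => ((‖b i‖ ^ 2 : ℝ) : ℂ) * (((2 * Real.pi) ^ n : ℝ) : ℂ))
      (∫ θ in Icc (0 : Fin n → ℝ) (fun _ => 2 * Real.pi), ((‖G θ‖ ^ 2 : ℝ) : ℂ)) := by
    have hinj : Function.Injective fun i : ι => (i, i) := fun i j h => (Prod.mk.inj h).1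
    rw [← hinj.hasSum_iff] at hHS
    · refine hHS.congr_fun fun i => ?_
      simp [Complex.mul_conj']
    · rintro ⟨i, j⟩ hij
      have : e i ≠ e j := fun h => hij ⟨i, by rw [he h]⟩
      simp [this]
  rw [integral_complex_ofReal] at hdiag
  have hreal : HasSum (fun i => ‖b i‖ ^ 2 * (2 * Real.pi) ^ n)
      (∫ θ in Icc (0 : Fin n → ℝ) (fun _ => 2 * Real.pi), ‖G θ‖ ^ 2) := by
    exact_mod_cast hdiag
  have hl : ∫⁻ θ in Icc (0 : Fin n → ℝ) (fun _ => 2 * Real.pi), ‖G θ‖ₑ ^ 2 =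
      ENNReal.ofReal (∫ θ in Icc (0 : Fin n → ℝ) (fun _ => 2 * Real.pi), ‖G θ‖ ^ 2) := by
    rw [ofReal_integral_eq_lintegral_ofReal]
    · refine lintegral_congr fun θ => ?_
      rw [ENNReal.ofReal_pow (norm_nonneg _), ofReal_norm]
    · exact (hGc.norm.pow 2).continuousOn.integrableOn_compact isCompact_Icc
    · exact ae_of_all _ fun θ => by positivity
  rw [hl, ← hreal.tsum_eq, tsum_mul_right, mul_comm, ENNReal.ofReal_mul (by positivity),
    ENNReal.ofReal_tsum_of_nonneg (fun i => by positivity)]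
  · congr 1
    refine tsum_congr fun i => ?_
    rw [ENNReal.ofReal_pow (norm_nonneg _), ofReal_norm]
  · have h2 : ((2 * Real.pi) ^ n : ℝ) ≠ 0 := by positivity
    exact (summable_mul_right_iff h2).mp hreal.summable

/-- The coefficients of a multiple power series are determined by its sum on a torus. -/
theorem eq_zero_of_tsum_torusChar_eq_zero {n : ℕ} {ι : Type*} {e : ι → Fin n → ℕ}
    (he : Function.Injective e) {b : ι → ℂ} (hb : Summable fun i => ‖b i‖)
    (h : ∀ θ, ∑' i, b i * torusChar (e i) θ = 0) (i : ι) : b i = 0 := by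
  have := lintegral_torus_enorm_sq he hb
  simp only [h, enorm_zero, ne_eq, OfNat.ofNat_ne_zero, not_false_eq_true, zero_pow,
    lintegral_const, zero_mul] at this
  have hpos : ENNReal.ofReal ((2 * Real.pi) ^ n) ≠ 0 := by
    rw [ne_eq, ENNReal.ofReal_eq_zero, not_le]; positivity
  have h0 := (mul_eq_zero.mp this.symm).resolve_left hpos
  simpa using ENNReal.tsum_eq_zero.mp h0 i

/-! ### The symmetrization map -/

/-- The monic polynomial with coefficients `(-1)^k u_k`, whose roots are the points of the fibre of
the symmetrization map over `u`. -/
noncomputable def symPoly {n : ℕ} (u : Fin n → ℂ) : Polynomial ℂ :=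
  ∑ c ∈ Finset.range (n + 1),
    Polynomial.C ((-1) ^ (n + c) * coord u ((n : ℤ) - c)) * Polynomial.X ^ c

theorem coeff_symPoly {n : ℕ} (u : Fin n → ℂ) (c : ℕ) :
    (symPoly u).coeff c = (-1) ^ (n + c) * coord u ((n : ℤ) - c) := by
  simp only [symPoly, Polynomial.finsetSum_coeff, Polynomial.coeff_C_mul, Polynomial.coeff_X_pow,
    mul_ite, mul_one, mul_zero, Finset.sum_ite_eq, Finset.mem_range]
  split_ifs with h
  · rfl
  · unfold coord
    rw [if_neg (by omega), dif_neg (by omega), mul_zero]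

theorem symPoly_symMap {n : ℕ} (z : Fin n → ℂ) :
    symPoly (symMap z) = ∏ i, (Polynomial.X - Polynomial.C (z i)) := by
  ext c
  have := coeff_prod_X_sub_C_eq_coord z 0 c
  rw [pow_zero, one_mul] at this
  rw [this, coeff_symPoly]
  simp

theorem coord_succ {n : ℕ} (u : Fin n → ℂ) (k : Fin n) : coord u ((k : ℤ) + 1) = u k := by
  unfold coord
  rw [if_neg (by omega), dif_pos (by omega)]
  simp

theorem symPoly_injective {n : ℕ} : Function.Injective (symPoly (n := n)) := by
  intro u v h
  funext k
  have h1 := congrArg (fun P => P.coeff (n - 1 - k)) h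
  simp only [coeff_symPoly] at h1
  have h2 := mul_left_cancel₀ (pow_ne_zero _ (by norm_num)) h1
  have h3 : ((n : ℤ) - ((n - 1 - k : ℕ) : ℤ)) = (k : ℤ) + 1 := by have := k.2; omega
  rwa [h3, coord_succ, coord_succ] at h2

theorem natDegree_symPoly {n : ℕ} (u : Fin n → ℂ) :
    (symPoly u).natDegree = n ∧ (symPoly u).Monic := by
  have h1 : (symPoly u).coeff n = 1 := by
    rw [coeff_symPoly, ← two_mul, pow_mul]
    simp [coord]
  have h2 : (symPoly u).natDegree ≤ n := by
    refine Polynomial.natDegree_le_iff_coeff_eq_zero.mpr fun c hc => ?_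
    rw [coeff_symPoly]
    unfold coord
    rw [if_neg (by omega), dif_neg (by omega), mul_zero]
  exact ⟨le_antisymm h2 (Polynomial.le_natDegree_of_ne_zero (by rw [h1]; exact one_ne_zero)),
    Polynomial.monic_of_natDegree_le_of_coeff_eq_one n h2 h1⟩

theorem surjective_symMap (n : ℕ) : Function.Surjective (symMap (n := n)) := by
  intro u
  obtain ⟨hdeg, hmonic⟩ := natDegree_symPoly u
  have hsplit := (IsAlgClosed.splits (symPoly u))
  have hcard : (symPoly u).roots.card = n := by
    exact hsplit.natDegree_eq_card_roots.symm.trans hdeg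
  have hprod : symPoly u = ((symPoly u).roots.map fun a => Polynomial.X - Polynomial.C a).prod := by
    exact hsplit.eq_prod_roots_of_monic hmonic
  set l := (symPoly u).roots.toList with hl
  have hlen : l.length = n := by rw [hl, Multiset.length_toList, hcard]
  refine ⟨fun i => l.get (i.cast hlen.symm), symPoly_injective ?_⟩
  rw [symPoly_symMap, hprod, ← Multiset.coe_toList (symPoly u).roots, ← hl, Multiset.map_coe,
    Multiset.prod_coe]
  clear_value l
  clear hl hcard hprod hsplit hdeg hmonic u
  subst hlen
  rw [← List.prod_ofFn]
  congr 1
  refine List.ext_get (by simp) fun i h1 h2 => ?_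
  simp

theorem eval_symPoly_symMap {n : ℕ} (z : Fin n → ℂ) (x : ℂ) :
    (symPoly (symMap z)).eval x = ∏ i, (x - z i) := by
  rw [symPoly_symMap, Polynomial.eval_prod]
  simp

theorem norm_coord_sub_le {n : ℕ} (u v : Fin n → ℂ) (k : ℤ) :
    ‖coord u k - coord v k‖ ≤ ‖u - v‖ := by
  unfold coord
  split_ifs
  · simp
  · exact norm_le_pi_norm (u - v) _
  · simp

/-- Quantitative continuity of roots: if the polynomial of z is coefficientwise close to that of z₀,
no root of it can have modulus at least R. These images are the open sets exhausting 𝔾ₙ on which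
Schur series converge normally. -/
theorem isOpen_symMap_image_ball {n : ℕ} {R : ℝ} (hR : R ≤ 1) :
    IsOpen (symMap '' Metric.ball (0 : Fin n → ℂ) R) := by
  rw [Metric.isOpen_iff]
  rintro _ ⟨z₀, hz₀, rfl⟩
  rw [mem_ball_zero_iff] at hz₀
  have hR0 : 0 < R := (norm_nonneg _).trans_lt hz₀
  set c := R - ‖z₀‖ with hc
  have hc0 : 0 < c := sub_pos.mpr hz₀
  -- The leading terms cancel, so the two polynomials differ in n coefficients only; dividing by n+1
  -- keeps the total below c^n.
  refine ⟨c ^ n / (n + 1), by positivity, fun u hu => ?_⟩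
  obtain ⟨z, rfl⟩ := surjective_symMap n u
  refine ⟨z, ?_, rfl⟩
  rw [mem_ball_zero_iff, pi_norm_lt_iff hR0]
  intro i
  by_contra hi
  rw [not_lt] at hi
  set x := z i with hx
  rw [mem_ball_iff_norm] at hu
  -- The root x is not bounded a priori, so both estimates are scaled by T. The lower one, ‖x‖ -
  -- ‖z₀‖ ≥ c T, uses R ≤ 1 when ‖x‖ > 1.
  set T := max 1 ‖x‖ with hT
  have hT1 : 1 ≤ T := le_max_left _ _
  have h0 : (symPoly (symMap z)).eval x = 0 := by
    rw [eval_symPoly_symMap]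
    exact Finset.prod_eq_zero (Finset.mem_univ i) (sub_self _)
  have hlow : (c * T) ^ n ≤ ‖(symPoly (symMap z₀)).eval x‖ := by
    rw [eval_symPoly_symMap, norm_prod, ← Fin.prod_const n (c * T)]
    refine Finset.prod_le_prod (fun _ _ => by positivity) fun j _ => ?_
    have h1 : ‖x‖ - ‖z₀‖ ≤ ‖x - z₀ j‖ :=
      (sub_le_sub_left (norm_le_pi_norm z₀ j) _).trans (norm_sub_norm_le _ _)
    refine le_trans ?_ h1
    rcases le_total ‖x‖ 1 with hx1 | hx1
    · rw [hT, max_eq_left hx1]; linarith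
    · rw [hT, max_eq_right hx1]
      nlinarith [norm_nonneg z₀]
  have hup : ‖(symPoly (symMap z₀)).eval x‖ ≤ n * (c ^ n / (n + 1) * T ^ n) := by
    have : (symPoly (symMap z₀)).eval x =
        ∑ k ∈ Finset.range n, (-1) ^ (n + k) * (coord (symMap z₀) ((n : ℤ) - k) -
          coord (symMap z) ((n : ℤ) - k)) * x ^ k := by
      rw [← sub_zero ((symPoly (symMap z₀)).eval x), ← h0]
      simp only [symPoly, Polynomial.eval_finsetSum, Polynomial.eval_mul, Polynomial.eval_C,
        Polynomial.eval_pow, Polynomial.eval_X]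
      rw [← Finset.sum_sub_distrib, Finset.sum_range_succ]
      simp only [sub_self, coord, if_true, mul_sub, sub_mul, add_zero]
    rw [this]
    refine (norm_sum_le _ _).trans ?_
    refine (Finset.sum_le_card_nsmul _ _ (c ^ n / (n + 1) * T ^ n) fun k hk => ?_).trans_eq
      (by simp)
    rw [norm_mul, norm_mul, norm_pow, norm_pow, norm_neg, norm_one, one_pow, one_mul]
    refine mul_le_mul ((norm_coord_sub_le _ _ _).trans ?_) ?_ (by positivity) (by positivity)
    · rw [norm_sub_rev]; exact hu.le
    · exact (pow_le_pow_left₀ (norm_nonneg _) (le_max_right _ _) k).trans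
        (pow_le_pow_right₀ hT1 (Finset.mem_range.mp hk).le)
  have hlt : (n : ℝ) * (c ^ n / (n + 1) * T ^ n) < (c * T) ^ n := by
    rw [mul_pow]
    have hp : 0 < c ^ n * T ^ n := by positivity
    have : (n : ℝ) * (c ^ n / (n + 1) * T ^ n) = (n / (n + 1)) * (c ^ n * T ^ n) := by
      field_simp
    rw [this]
    exact mul_lt_of_lt_one_left hp ((div_lt_one (by positivity)).mpr (by linarith))
  exact absurd (hlow.trans hup) (not_le.mpr hlt)

theorem polydisc_eq_ball (n : ℕ) : polydisc n = Metric.ball (0 : Fin n → ℂ) 1 := by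
  ext z
  rw [mem_ball_zero_iff, pi_norm_lt_iff one_pos]
  rfl

theorem isOpen_polydisc (n : ℕ) : IsOpen (polydisc n) := by
  rw [polydisc_eq_ball]; exact Metric.isOpen_ball

theorem differentiable_symMap {n : ℕ} : Differentiable ℂ (symMap (n := n)) := by
  unfold symMap
  fun_prop

theorem differentiable_coord {n : ℕ} (k : ℤ) :
    Differentiable ℂ fun u : Fin n → ℂ => coord u k := by
  unfold coord
  split_ifs <;> fun_prop

theorem differentiable_giambelliDet {n : ℕ} (p : Parts n) : Differentiable ℂ (giambelliDet p) := by
  unfold giambelliDet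
  simp only [Matrix.det_apply, Matrix.of_apply]
  have := differentiable_coord (n := n)
  fun_prop

theorem differentiable_jac {n : ℕ} : Differentiable ℂ (jac (n := n)) := by
  unfold jac
  fun_prop

/-! ### Growth of the Schur polynomials and of their weights -/

/-- The total degree `|𝐩 + δ|`. -/
def degree {n : ℕ} (p : Parts n) : ℕ := ∑ j, (p.1 + delta n) j

theorem norm_eval_alternant_le {n : ℕ} (m : Fin n → ℕ) {z : Fin n → ℂ} {R : ℝ}
    (hz : ∀ i, ‖z i‖ ≤ R) :
    ‖MvPolynomial.eval z (alternant m)‖ ≤ n.factorial * R ^ ∑ j, m j := by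
  rw [eval_alternant, Matrix.det_apply']
  refine (norm_sum_le _ _).trans ?_
  refine (Finset.sum_le_card_nsmul _ _ (R ^ ∑ j, m j) fun σ _ => ?_).trans_eq ?_
  · rw [norm_mul]
    have hs : ‖((Equiv.Perm.sign σ : ℤ) : ℂ)‖ = 1 := by
      rcases Int.units_eq_one_or (Equiv.Perm.sign σ) with h | h <;> simp [h]
    rw [hs, one_mul, norm_prod, ← Finset.prod_pow_eq_pow_sum]
    refine Finset.prod_le_prod (fun _ _ => norm_nonneg _) fun i _ => ?_
    rw [Matrix.of_apply, norm_pow]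
    exact pow_le_pow_left₀ (norm_nonneg _) (hz _) _
  · simp [Fintype.card_perm]

/-- The numerator of S_𝐩 = a_{𝐩+δ}/Δ is easily bounded, but Δ has zeros. On a torus with pairwise
distinct radii |Δ| is bounded below, and the maximum principle carries the estimate inside. -/
theorem exists_norm_giambelliDet_le {n : ℕ} {R' R : ℝ} (hR' : 0 ≤ R') (hR : R' < R) :
    ∃ C : ℝ, 0 ≤ C ∧ ∀ p : Parts n, ∀ u ∈ symMap '' Metric.ball (0 : Fin n → ℂ) R',
      ‖giambelliDet p u‖ ≤ C * R ^ degree p := by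
  -- Equally spaced radii, all strictly above R' and at most R.
  set ρ : Fin n → ℝ := fun i => R' + (R - R') * (((i : ℕ) + 1 : ℝ) / (n + 1)) with hρ
  have hpos : 0 < R - R' := sub_pos.mpr hR
  have hρ0 : ∀ i, R' < ρ i := fun i => lt_add_of_pos_right _ (by positivity)
  have hρR : ∀ i, ρ i ≤ R := fun i => by
    have h1 : (((i : ℕ) + 1 : ℝ) / (n + 1)) ≤ 1 := by
      rw [div_le_one (by positivity)]
      have : ((i : ℕ) : ℝ) ≤ n := by exact_mod_cast i.2.le
      linarith
    have := mul_le_mul_of_nonneg_left h1 hpos.le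
    simp only [hρ]
    linarith
  have hinj : ∀ i j, i ≠ j → 0 < |ρ i - ρ j| := fun i j hij => by
    rw [abs_pos, sub_ne_zero]
    intro h
    simp only [hρ, add_right_inj, mul_eq_mul_left_iff, hpos.ne', or_false] at h
    rw [div_left_inj' (by positivity)] at h
    exact hij (Fin.ext (by exact_mod_cast add_right_cancel h))
  set d : ℝ := ∏ i : Fin n, ∏ j ∈ Finset.Ioi i, |ρ i - ρ j| with hd
  have hd0 : 0 < d := Finset.prod_pos fun i _ => Finset.prod_pos fun j hj =>
    hinj i j (Finset.mem_Ioi.mp hj).ne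
  refine ⟨n.factorial / d, by positivity, ?_⟩
  rintro p _ ⟨z, hz, rfl⟩
  rw [mem_ball_zero_iff] at hz
  refine norm_le_of_forall_torus_norm_le (F := fun z => giambelliDet p (symMap z))
    ((differentiable_giambelliDet p).comp differentiable_symMap)
    (fun i => hR'.trans_lt (hρ0 i)) (fun w hw => ?_)
    (fun i => (norm_le_pi_norm z i).trans (hz.le.trans (hρ0 i).le))
  have hjac : d ≤ ‖jac w‖ := by
    rw [hd, jac, norm_prod]
    refine Finset.prod_le_prod (fun i _ => Finset.prod_nonneg fun j _ => abs_nonneg _)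
      fun i _ => ?_
    rw [norm_prod]
    refine Finset.prod_le_prod (fun j _ => abs_nonneg _) fun j _ => ?_
    rw [← hw i, ← hw j]
    exact abs_norm_sub_norm_le _ _
  have h1 := congrArg norm (jac_mul_giambelliDet p w)
  rw [norm_mul] at h1
  have h2 : ‖jac w‖ * ‖giambelliDet p (symMap w)‖ ≤ n.factorial * R ^ degree p :=
    h1.trans_le (norm_eval_alternant_le _ fun i => (hw i).trans_le (hρR i))
  rw [div_mul_eq_mul_div, le_div_iff₀ hd0, mul_comm]
  exact (mul_le_mul_of_nonneg_right hjac (norm_nonneg _)).trans h2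

theorem gammaSq_eq_prod {n : ℕ} (μ : ℝ) (p : Parts n) :
    gammaSq μ p = ∏ j, (ascPochhammer ℝ ((p.1 + delta n) j)).eval μ /
      (((p.1 + delta n) j).factorial : ℝ) := by
  rw [gammaSq, multiPochhammer, multiFactorial, Finset.prod_div_distrib]

theorem gammaSq_pos {n : ℕ} {μ : ℝ} (hμ : 0 < μ) (p : Parts n) : 0 < gammaSq μ p := by
  rw [gammaSq_eq_prod]
  exact Finset.prod_pos fun j _ => div_pos (ascPochhammer_pos _ _ hμ) (by positivity)

theorem summable_ascPochhammer_div_factorial_mul_pow {μ R : ℝ} (hμ : 0 < μ) (hR0 : 0 ≤ R)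
    (hR : R < 1) : Summable fun k : ℕ => (ascPochhammer ℝ k).eval μ / (k.factorial : ℝ) * R ^ k := by
  rcases hR0.eq_or_lt with rfl | hR0
  · refine summable_of_ne_finset_zero (s := {0}) fun k hk => ?_
    rw [zero_pow (by simpa using hk), mul_zero]
  have hne : ∀ k : ℕ, 0 < (ascPochhammer ℝ k).eval μ / (k.factorial : ℝ) * R ^ k := fun k =>
    mul_pos (div_pos (ascPochhammer_pos _ _ hμ) (by positivity)) (by positivity)
  refine summable_of_ratio_test_tendsto_lt_one hR (Eventually.of_forall fun k => (hne k).ne') ?_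
  have h1 : ∀ k : ℕ, ‖(ascPochhammer ℝ (k + 1)).eval μ / ((k + 1).factorial : ℝ) * R ^ (k + 1)‖ /
      ‖(ascPochhammer ℝ k).eval μ / (k.factorial : ℝ) * R ^ k‖ =
      (1 + (μ - 1) * (1 / ((k : ℝ) + 1))) * R := by
    intro k
    rw [Real.norm_of_nonneg (hne k).le, Real.norm_of_nonneg (hne (k + 1)).le,
      ascPochhammer_succ_eval, Nat.factorial_succ]
    have := (ascPochhammer_pos k μ hμ).ne'
    push_cast
    field_simp
    ring
  simp_rw [h1]
  have h2 := ((tendsto_one_div_add_atTop_nhds_zero_nat (𝕜 := ℝ)).const_mul (μ - 1)).const_add 1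
  simpa using h2.mul_const R

theorem injective_add_delta (n : ℕ) : Function.Injective fun p : Parts n => p.1 + delta n :=
  fun _ _ h => Subtype.ext (add_right_cancel h)

instance (n : ℕ) : Countable (Parts n) := (injective_add_delta n).countable

/-- The series is a subseries, along 𝐩 ↦ 𝐩 + δ, of a product of n one-variable binomial series. -/
theorem summable_gammaSq_mul_pow {n : ℕ} {μ R : ℝ} (hμ : 0 < μ) (hR0 : 0 ≤ R) (hR : R < 1) :
    Summable fun p : Parts n => gammaSq μ p * R ^ degree p := by
  have h1 := summable_ascPochhammer_div_factorial_mul_pow hμ hR0 hR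
  have h2 := (hasSum_prod_pi (n := n) (fun _ => h1.norm) (fun _ => h1.hasSum)).1.summable
  refine (h2.comp_injective (injective_add_delta n)).congr fun p => ?_
  simp only [Function.comp]
  rw [Finset.prod_mul_distrib, ← gammaSq_eq_prod, Finset.prod_pow_eq_pow_sum]
  rfl

/-! ### Series of Schur polynomials -/

/-- The sum of a series of Schur polynomials, in the coordinates of the symmetrized polydisc. -/
noncomputable def schurSum {n : ℕ} (c : Parts n → ℂ) (u : Fin n → ℂ) : ℂ :=
  ∑' p, c p * giambelliDet p u

/-- Coefficients of subexponential growth. -/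
def IsSubexponential {n : ℕ} (c : Parts n → ℂ) : Prop :=
  ∀ R : ℝ, 0 ≤ R → R < 1 → Summable fun p => ‖c p‖ * R ^ degree p

theorem exists_ball_of_mem_symPolydisc {n : ℕ} {u : Fin n → ℂ} (hu : u ∈ symPolydisc n) :
    ∃ R : ℝ, 0 ≤ R ∧ R < 1 ∧ u ∈ symMap '' Metric.ball (0 : Fin n → ℂ) R := by
  obtain ⟨z, hz, rfl⟩ := hu
  rw [polydisc_eq_ball, mem_ball_zero_iff] at hz
  obtain ⟨R, h1, h2⟩ := exists_between hz
  exact ⟨R, (norm_nonneg z).trans h1.le, h2, z, by rwa [mem_ball_zero_iff], rfl⟩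

theorem IsSubexponential.exists_bound {n : ℕ} {c : Parts n → ℂ} (hc : IsSubexponential c) {R : ℝ}
    (hR0 : 0 ≤ R) (hR : R < 1) : ∃ M : Parts n → ℝ, Summable M ∧
      ∀ p, ∀ u ∈ symMap '' Metric.ball (0 : Fin n → ℂ) R, ‖c p * giambelliDet p u‖ ≤ M p := by
  obtain ⟨R', h1, h2⟩ := exists_between hR
  obtain ⟨C, hC0, hC⟩ := exists_norm_giambelliDet_le (n := n) hR0 h1
  refine ⟨fun p => C * (‖c p‖ * R' ^ degree p), (hc R' (hR0.trans h1.le) h2).mul_left C,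
    fun p u hu => ?_⟩
  rw [norm_mul]
  exact (mul_le_mul_of_nonneg_left (hC p u hu) (norm_nonneg _)).trans_eq (mul_left_comm _ _ _)

theorem IsSubexponential.summable {n : ℕ} {c : Parts n → ℂ} (hc : IsSubexponential c)
    {u : Fin n → ℂ} (hu : u ∈ symPolydisc n) : Summable fun p => ‖c p * giambelliDet p u‖ := by
  obtain ⟨R, hR0, hR, hu⟩ := exists_ball_of_mem_symPolydisc hu
  obtain ⟨M, hM, h⟩ := hc.exists_bound hR0 hR
  exact Summable.of_nonneg_of_le (fun _ => norm_nonneg _) (fun p => h p u hu) hM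

theorem IsSubexponential.differentiableOn {n : ℕ} {c : Parts n → ℂ} (hc : IsSubexponential c) :
    DifferentiableOn ℂ (schurSum c) (symPolydisc n) := by
  intro u hu
  obtain ⟨R, hR0, hR, hu'⟩ := exists_ball_of_mem_symPolydisc hu
  obtain ⟨M, hM, h⟩ := hc.exists_bound hR0 hR
  have hopen := isOpen_symMap_image_ball (n := n) hR.le
  exact ((differentiableOn_tsum_of_norm_le hopen hM (fun p =>
    ((differentiable_giambelliDet p).const_mul (c p)).differentiableOn) h).differentiableAt
    (hopen.mem_nhds hu')).differentiableWithinAt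

theorem strictAnti_add_delta {n : ℕ} (p : Parts n) : StrictAnti (p.1 + delta n) := by
  intro i j hij
  have h1 := p.2 hij.le
  have h2 : delta n j < delta n i := by
    simp only [delta]
    have := Fin.lt_def.mp hij
    omega
  simp only [Pi.add_apply]
  omega

/-- The exponents of the monomials of the alternants `a_{𝐩 + δ}`. -/
def alternantExp {n : ℕ} (x : Parts n × Equiv.Perm (Fin n)) : Fin n → ℕ :=
  (x.1.1 + delta n) ∘ x.2

/-- The entries of 𝐩 + δ strictly decrease, so their set determines 𝐩 and their order determines the
permutation. Hence no monomial occurs twice among all the alternants. -/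
theorem alternantExp_injective (n : ℕ) : Function.Injective (alternantExp (n := n)) := by
  rintro ⟨p, σ⟩ ⟨q, τ⟩ h
  have h' : (p.1 + delta n) ∘ σ = (q.1 + delta n) ∘ τ := h
  have hr : Set.range (p.1 + delta n) = Set.range (q.1 + delta n) := by
    rw [← σ.surjective.range_comp (p.1 + delta n), h', τ.surjective.range_comp]
  have hpq : p.1 + delta n = q.1 + delta n := by
    have hm1 : StrictMono ((p.1 + delta n) ∘ Fin.rev) :=
      (strictAnti_add_delta p).comp Fin.rev_strictAnti
    have hm2 : StrictMono ((q.1 + delta n) ∘ Fin.rev) :=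
      (strictAnti_add_delta q).comp Fin.rev_strictAnti
    have h3 := (StrictMono.range_inj hm1 hm2).mp (by
      rw [Fin.rev_surjective.range_comp, Fin.rev_surjective.range_comp, hr])
    exact Fin.rev_surjective.injective_comp_right h3
  have hp : p = q := injective_add_delta n hpq
  subst hp
  refine Prod.ext rfl (Equiv.ext fun i => ?_)
  exact (strictAnti_add_delta p).injective (congrFun h' i)

theorem exists_alternantExp_eq {n : ℕ} {m : Fin n → ℕ} (hm : Function.Injective m) :
    ∃ x, alternantExp x = m := by
  let τ : Equiv.Perm (Fin n) := Fin.revPerm.trans (Tuple.sort m)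
  have hanti : Antitone (m ∘ τ) := (Tuple.monotone_sort m).comp_antitone Fin.rev_anti
  have hsa : StrictAnti (m ∘ τ) := hanti.strictAnti_of_injective (hm.comp τ.injective)
  -- A strictly decreasing sequence of naturals drops by at least one at each index. This makes the
  -- subtraction of δ exact and its result weakly decreasing.
  have hstep : ∀ i j : Fin n, i ≤ j → m (τ j) + ((j : ℕ) - i) ≤ m (τ i) := by
    intro i j hij
    obtain ⟨d, hd⟩ := Nat.exists_eq_add_of_le (Fin.le_def.mp hij)
    induction d generalizing j with
    | zero =>
      have : i = j := Fin.ext (by omega)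
      subst this; simp
    | succ d ih =>
      have hlt : (i : ℕ) + d < n := by omega
      have h1 := ih ⟨i + d, hlt⟩ (Fin.le_def.mpr (by simp)) (by simp)
      have h2 : m (τ j) < m (τ ⟨i + d, hlt⟩) := hsa (Fin.lt_def.mpr (by simp; omega))
      simp only at h1
      omega
  have hge : ∀ i : Fin n, delta n i ≤ m (τ i) := by
    intro i
    have hi := i.2
    have hlt : n - 1 < n := by omega
    have := hstep i ⟨n - 1, hlt⟩ (Fin.le_def.mpr (by simp; omega))
    simp only [delta] at *
    omega
  refine ⟨(⟨fun i => m (τ i) - delta n i, fun i j hij => ?_⟩, τ.symm), ?_⟩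
  · have h1 := hstep i j hij
    have h2 := hge i
    have h3 := hge j
    have h4 := Fin.le_def.mp hij
    simp only [delta] at *
    omega
  · funext i
    simp only [alternantExp, Function.comp, Pi.add_apply]
    rw [Nat.sub_add_cancel (hge _), Equiv.apply_symm_apply]

/-- The terms of the power series of `Δ · (schurSum c ∘ 𝐬)`. -/
noncomputable def alternantTerm {n : ℕ} (c : Parts n → ℂ) (z : Fin n → ℂ)
    (x : Parts n × Equiv.Perm (Fin n)) : ℂ :=
  ((Equiv.Perm.sign x.2 : ℤ) : ℂ) * c x.1 * ∏ i, z i ^ alternantExp x i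

theorem norm_sign {n : ℕ} (σ : Equiv.Perm (Fin n)) : ‖((Equiv.Perm.sign σ : ℤ) : ℂ)‖ = 1 := by
  rcases Int.units_eq_one_or (Equiv.Perm.sign σ) with h | h <;> simp [h]

theorem norm_alternantTerm {n : ℕ} (c : Parts n → ℂ) (z : Fin n → ℂ)
    (x : Parts n × Equiv.Perm (Fin n)) :
    ‖alternantTerm c z x‖ = ‖c x.1‖ * ∏ i, ‖z i‖ ^ alternantExp x i := by
  simp only [alternantTerm, norm_mul, norm_sign, one_mul, norm_prod, norm_pow]

theorem sum_alternantExp {n : ℕ} (x : Parts n × Equiv.Perm (Fin n)) :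
    ∑ i, alternantExp x i = degree x.1 :=
  Equiv.sum_comp x.2 (x.1.1 + delta n)

theorem IsSubexponential.summable_alternantTerm {n : ℕ} {c : Parts n → ℂ}
    (hc : IsSubexponential c) {z : Fin n → ℂ} (hz : z ∈ polydisc n) :
    Summable fun x => ‖alternantTerm c z x‖ := by
  rw [polydisc_eq_ball, mem_ball_zero_iff] at hz
  have h1 := hc ‖z‖ (norm_nonneg _) hz
  have h2 : Summable fun x : Parts n × Equiv.Perm (Fin n) => ‖c x.1‖ * ‖z‖ ^ degree x.1 := by
    have := h1.mul_of_nonneg (g := fun _ : Equiv.Perm (Fin n) => (1 : ℝ)) (Summable.of_finite)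
      (fun p => by positivity) (fun _ => by simp)
    simpa using this
  refine Summable.of_nonneg_of_le (fun _ => norm_nonneg _) (fun x => ?_) h2
  rw [norm_alternantTerm, ← sum_alternantExp, ← Finset.prod_pow_eq_pow_sum]
  gcongr
  exact norm_le_pi_norm z _

theorem sum_alternantTerm {n : ℕ} (c : Parts n → ℂ) (z : Fin n → ℂ) (p : Parts n) :
    ∑ σ, alternantTerm c z (p, σ) = jac z * (c p * giambelliDet p (symMap z)) := by
  rw [mul_left_comm, jac_mul_giambelliDet, eval_alternant, ← Matrix.det_transpose,
    Matrix.det_apply', Finset.mul_sum]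
  refine Finset.sum_congr rfl fun σ _ => ?_
  simp only [alternantTerm, alternantExp, Matrix.transpose_apply, Matrix.of_apply, Function.comp]
  ring

theorem IsSubexponential.tsum_alternantTerm {n : ℕ} {c : Parts n → ℂ}
    (hc : IsSubexponential c) {z : Fin n → ℂ} (hz : z ∈ polydisc n) :
    ∑' x, alternantTerm c z x = jac z * schurSum c (symMap z) := by
  rw [(hc.summable_alternantTerm hz).of_norm.tsum_prod, schurSum, ← tsum_mul_left]
  refine tsum_congr fun p => ?_
  rw [tsum_fintype, sum_alternantTerm]

/-- The rotation of `z` by the angles `θ`. -/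
noncomputable def rotate {n : ℕ} (θ : Fin n → ℝ) (z : Fin n → ℂ) : Fin n → ℂ :=
  fun i => Complex.exp (θ i * Complex.I) * z i

theorem rotate_mem_polydisc {n : ℕ} (θ : Fin n → ℝ) (z : Fin n → ℂ) :
    rotate θ z ∈ polydisc n ↔ z ∈ polydisc n := by
  simp [polydisc, rotate, Complex.norm_exp_ofReal_mul_I]

theorem alternantTerm_rotate {n : ℕ} (c : Parts n → ℂ) (z : Fin n → ℂ) (θ : Fin n → ℝ)
    (x : Parts n × Equiv.Perm (Fin n)) :
    alternantTerm c (rotate θ z) x = alternantTerm c z x * torusChar (alternantExp x) θ := by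
  simp only [alternantTerm, rotate, mul_pow, Finset.prod_mul_distrib, torusChar]
  ring

/-- Rotation multiplies the terms by characters with distinct exponents, so Parseval applies. Both
norm computations use this: at equal moduli for the Hardy norm, inside an integral over z for the
Bergman norm. -/
theorem IsSubexponential.lintegral_rotate {n : ℕ} {c : Parts n → ℂ}
    (hc : IsSubexponential c) {z : Fin n → ℂ} (hz : z ∈ polydisc n) :
    ∫⁻ θ in Icc (0 : Fin n → ℝ) (fun _ => 2 * Real.pi),
      ‖jac (rotate θ z) * schurSum c (symMap (rotate θ z))‖ₑ ^ 2 =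
      ENNReal.ofReal ((2 * Real.pi) ^ n) * ∑' x, ‖alternantTerm c z x‖ₑ ^ 2 := by
  rw [← lintegral_torus_enorm_sq (alternantExp_injective n) (hc.summable_alternantTerm hz)]
  refine lintegral_congr fun θ => ?_
  rw [← hc.tsum_alternantTerm ((rotate_mem_polydisc θ z).mpr hz)]
  simp_rw [alternantTerm_rotate]

theorem const_mem_polydisc {n : ℕ} {R : ℝ} (hR0 : 0 ≤ R) (hR : R < 1) :
    (fun _ => (R : ℂ)) ∈ polydisc n := fun _ => by
  rwa [Complex.norm_real, Real.norm_of_nonneg hR0]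

theorem IsSubexponential.eq_zero {n : ℕ} {c : Parts n → ℂ} (hc : IsSubexponential c)
    (h : ∀ u ∈ symPolydisc n, schurSum c u = 0) : c = 0 := by
  have hz : (fun _ => ((1 / 2 : ℝ) : ℂ)) ∈ polydisc n := const_mem_polydisc (by norm_num) (by norm_num)
  funext p
  have := eq_zero_of_tsum_torusChar_eq_zero (alternantExp_injective n)
    (hc.summable_alternantTerm hz) (fun θ => ?_) (p, 1)
  · simpa [alternantTerm, Finset.prod_eq_zero_iff] using this
  · have h1 := (rotate_mem_polydisc θ _).mpr hz
    simp_rw [← alternantTerm_rotate]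
    rw [hc.tsum_alternantTerm h1, h _ (mem_image_of_mem _ h1), mul_zero]

/-! ### The Hardy norm -/

theorem tsum_enorm_sq_alternantTerm_const {n : ℕ} (c : Parts n → ℂ) {r : ℝ} (hr : 0 ≤ r) :
    ∑' x, ‖alternantTerm c (fun _ => (r : ℂ)) x‖ₑ ^ 2 =
      n.factorial * ∑' p, ENNReal.ofReal ((r ^ degree p) ^ 2) * ‖c p‖ₑ ^ 2 := by
  rw [ENNReal.tsum_prod', ← ENNReal.tsum_mul_left]
  refine tsum_congr fun p => ?_
  have : ∀ σ : Equiv.Perm (Fin n), ‖alternantTerm c (fun _ => (r : ℂ)) (p, σ)‖ₑ ^ 2 =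
      ENNReal.ofReal ((r ^ degree p) ^ 2) * ‖c p‖ₑ ^ 2 := by
    intro σ
    rw [← ofReal_norm, norm_alternantTerm, Complex.norm_real, Real.norm_of_nonneg hr,
      Finset.prod_pow_eq_pow_sum, sum_alternantExp, ← ofReal_norm,
      ← ENNReal.ofReal_pow (by positivity), ← ENNReal.ofReal_pow (by positivity),
      ← ENNReal.ofReal_mul (by positivity)]
    congr 1
    ring
  simp_rw [this]
  rw [tsum_fintype, Finset.sum_const, Finset.card_univ, Fintype.card_perm, Fintype.card_fin,
    nsmul_eq_mul]

theorem iSup_tsum_ofReal_pow_mul {ι : Type*} (k : ι → ℕ) (a : ι → ℝ≥0∞) :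
    ⨆ r : Ioo (0 : ℝ) 1, ∑' i, ENNReal.ofReal (((r : ℝ) ^ k i) ^ 2) * a i = ∑' i, a i := by
  refine le_antisymm (iSup_le fun r => ENNReal.tsum_le_tsum fun i => ?_) ?_
  · refine mul_le_of_le_one_left zero_le (ENNReal.ofReal_le_one.mpr ?_)
    exact pow_le_one₀ (pow_nonneg r.2.1.le _) (pow_le_one₀ r.2.1.le r.2.2.le)
  -- Only finite partial sums are passed to the limit r → 1; each is bounded by the supremum of the
  -- full sums.
  · rw [ENNReal.tsum_eq_iSup_sum]
    refine iSup_le fun s => ?_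
    have hlim : Tendsto (fun r : ℝ => ∑ i ∈ s, ENNReal.ofReal ((r ^ k i) ^ 2) * a i)
        (𝓝[<] 1) (𝓝 (∑ i ∈ s, ENNReal.ofReal (((1 : ℝ) ^ k i) ^ 2) * a i)) := by
      refine tendsto_finsetSum _ fun i _ => ?_
      refine ENNReal.Tendsto.mul_const ?_ (Or.inl (by simp))
      have hc : Continuous fun r : ℝ => ENNReal.ofReal ((r ^ k i) ^ 2) :=
        ENNReal.continuous_ofReal.comp (by fun_prop)
      exact hc.continuousWithinAt
    simp only [one_pow, ENNReal.ofReal_one, one_mul] at hlim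
    refine le_of_tendsto hlim ?_
    filter_upwards [Ioo_mem_nhdsLT (zero_lt_one' ℝ)] with r hr
    exact (ENNReal.sum_le_tsum s).trans
      (le_iSup (fun r : Ioo (0 : ℝ) 1 => ∑' i, ENNReal.ofReal (((r : ℝ) ^ k i) ^ 2) * a i) ⟨r, hr⟩)

theorem IsSubexponential.hardyNormSq_eq {n : ℕ} {c : Parts n → ℂ} (hc : IsSubexponential c) :
    hardyNormSq (fun u : symPolydisc n => schurSum c u) = ∑' p, ‖c p‖ₑ ^ 2 := by
  rw [← iSup_tsum_ofReal_pow_mul degree, hardyNormSq]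
  refine iSup_congr fun r => ?_
  have hz : (fun _ : Fin n => ((r : ℝ) : ℂ)) ∈ polydisc n := const_mem_polydisc r.2.1.le r.2.2
  have h1 := hc.lintegral_rotate hz
  rw [tsum_enorm_sq_alternantTerm_const c r.2.1.le] at h1
  have h2 : ∀ θ : Fin n → ℝ, ‖schurSum c (symMapOn n (torusPoint r θ) : Fin n → ℂ)‖ₑ ^ 2 *
      ‖jac (torusPoint r θ : Fin n → ℂ)‖ₑ ^ 2 =
      ‖jac (rotate θ fun _ => ((r : ℝ) : ℂ)) *
        schurSum c (symMap (rotate θ fun _ => ((r : ℝ) : ℂ)))‖ₑ ^ 2 := by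
    intro θ
    have : (torusPoint r θ : Fin n → ℂ) = rotate θ fun _ => ((r : ℝ) : ℂ) := by
      funext j
      exact mul_comm _ _
    have h3 : (symMapOn n (torusPoint r θ) : Fin n → ℂ) = symMap (torusPoint r θ : Fin n → ℂ) := rfl
    rw [h3, this, enorm_mul, mul_pow, mul_comm]
  simp_rw [h2]
  rw [h1, ← mul_assoc, ← mul_assoc, ← ENNReal.ofReal_mul (by positivity),
    ← ENNReal.ofReal_natCast n.factorial, ← ENNReal.ofReal_mul (by positivity)]
  have : 1 / ((n.factorial : ℝ) * (2 * Real.pi) ^ n) * (2 * Real.pi) ^ n * n.factorial = 1 := by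
    field_simp
  rw [this, ENNReal.ofReal_one, one_mul]

/-! ### Expansion of holomorphic functions into Schur polynomials -/

theorem powerSeries_coeff_unique {n : ℕ} {a b : (Fin n → ℕ) → ℂ} {F : (Fin n → ℂ) → ℂ} {ρ : ℝ}
    (hρ : 0 < ρ)
    (ha : ∀ z : Fin n → ℂ, (∀ i, ‖z i‖ < ρ) → HasSum (fun m => a m * ∏ i, z i ^ m i) (F z))
    (hb : ∀ z : Fin n → ℂ, (∀ i, ‖z i‖ < ρ) → HasSum (fun m => b m * ∏ i, z i ^ m i) (F z)) :
    a = b := by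
  have hr : (0 : ℝ) ≤ ρ / 2 := by positivity
  have hz : ∀ i : Fin n, ‖(fun _ => ((ρ / 2 : ℝ) : ℂ)) i‖ < ρ := fun i => by
    rw [Complex.norm_real, Real.norm_of_nonneg hr]; linarith
  have hd := fun (z : Fin n → ℂ) hz => (ha z hz).sub (hb z hz)
  simp only [sub_self, ← sub_mul] at hd
  funext m
  have := eq_zero_of_tsum_torusChar_eq_zero (e := id) Function.injective_id
    (hd _ hz).summable.norm (fun θ => ?_) m
  · have hne : ((ρ / 2 : ℝ) : ℂ) ≠ 0 := by exact_mod_cast (half_pos hρ).ne'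
    have h1 := (mul_eq_zero.mp this).resolve_right
      (Finset.prod_ne_zero_iff.mpr fun i _ => pow_ne_zero _ hne)
    exact sub_eq_zero.mp h1
  · have hz' : ∀ i : Fin n, ‖rotate θ (fun _ => ((ρ / 2 : ℝ) : ℂ)) i‖ < ρ := fun i => by
      rw [rotate, norm_mul, Complex.norm_exp_ofReal_mul_I, one_mul]
      exact hz i
    rw [← (hd _ hz').tsum_eq]
    refine tsum_congr fun k => ?_
    simp only [rotate, mul_pow, Finset.prod_mul_distrib, torusChar, id]
    ring

/-- Expansions obtained at different radii have the same coefficients by uniqueness, so those found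
at radius 1/2 serve on the whole polydisc. -/
theorem exists_hasSum_polydisc {n : ℕ} {F : (Fin n → ℂ) → ℂ}
    (hF : DifferentiableOn ℂ F (polydisc n)) :
    ∃ a : (Fin n → ℕ) → ℂ, ∀ z ∈ polydisc n, HasSum (fun m => a m * ∏ i, z i ^ m i) (F z) := by
  obtain ⟨a, ha⟩ := exists_hasSum_of_differentiableOn hF one_half_pos one_half_lt_one
  refine ⟨a, fun z hz => ?_⟩
  rw [polydisc_eq_ball, mem_ball_zero_iff] at hz
  obtain ⟨ρ, h1, h2⟩ := exists_between (max_lt hz one_half_lt_one)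
  have hρ : 1 / 2 < ρ := (le_max_right _ _).trans_lt h1
  obtain ⟨b, hb⟩ := exists_hasSum_of_differentiableOn hF (one_half_pos.trans hρ) h2
  have hab : a = b := powerSeries_coeff_unique one_half_pos ha fun z hz =>
    hb z fun i => (hz i).trans hρ
  rw [hab]
  exact hb z fun i => (norm_le_pi_norm z i).trans_lt ((le_max_left _ _).trans_lt h1)

theorem jac_comp_perm {n : ℕ} (z : Fin n → ℂ) (σ : Equiv.Perm (Fin n)) :
    jac (z ∘ σ) = ((Equiv.Perm.sign σ : ℤ) : ℂ) * jac z := by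
  rw [jac_eq_alternant, jac_eq_alternant, eval_alternant, eval_alternant, ← Matrix.det_permute]
  rfl

theorem symMap_comp_perm {n : ℕ} (z : Fin n → ℂ) (σ : Equiv.Perm (Fin n)) :
    symMap (z ∘ σ) = symMap z := by
  refine symPoly_injective ?_
  rw [symPoly_symMap, symPoly_symMap]
  exact Equiv.prod_comp σ fun i => Polynomial.X - Polynomial.C (z i)

/-- Antisymmetry of Δ·(g ∘ 𝐬) passes to its Taylor coefficients: they change by the sign under
permutation of the exponents and vanish at repeated ones. Every surviving orbit contains exactly one
𝐩 + δ and sums to a multiple of its alternant. -/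
theorem exists_eq_schurSum {n : ℕ} {g : (Fin n → ℂ) → ℂ}
    (hg : DifferentiableOn ℂ g (symPolydisc n)) :
    ∃ c : Parts n → ℂ, IsSubexponential c ∧ ∀ u ∈ symPolydisc n, g u = schurSum c u := by
  have hmaps : MapsTo symMap (polydisc n) (symPolydisc n) := fun z hz => mem_image_of_mem _ hz
  have hF : DifferentiableOn ℂ (fun z => jac z * g (symMap z)) (polydisc n) :=
    differentiable_jac.differentiableOn.mul
      (hg.comp differentiable_symMap.differentiableOn hmaps)
  obtain ⟨a, ha⟩ := exists_hasSum_polydisc hF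
  have hanti : ∀ (σ : Equiv.Perm (Fin n)) m, a (m ∘ σ) = ((Equiv.Perm.sign σ : ℤ) : ℂ) * a m := by
    intro σ m
    refine congrFun (powerSeries_coeff_unique one_pos (a := fun m => a (m ∘ σ))
      (b := fun m => ((Equiv.Perm.sign σ : ℤ) : ℂ) * a m)
      (F := fun z => ((Equiv.Perm.sign σ : ℤ) : ℂ) * (jac z * g (symMap z))) ?_ ?_) m
    · intro z hz
      have h1 := ha (z ∘ σ) fun i => hz _
      rw [jac_comp_perm, symMap_comp_perm, mul_assoc,
        ← (Equiv.arrowCongr σ (Equiv.refl ℕ)).symm.hasSum_iff] at h1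
      refine h1.congr_fun fun m => ?_
      simp only [Function.comp, Equiv.arrowCongr_symm, Equiv.arrowCongr_apply, Equiv.symm_symm,
        Equiv.refl_symm, Equiv.coe_refl, id]
      congr 1
      exact (Equiv.prod_comp σ fun i => z i ^ m i).symm
    · intro z hz
      refine ((ha z hz).mul_left _).congr_fun fun m => ?_
      rw [mul_assoc]
  have hzero : ∀ m, m ∉ Set.range (alternantExp (n := n)) → a m = 0 := by
    intro m hm
    have hinj : ¬ Function.Injective m := fun h => hm (exists_alternantExp_eq h)
    simp only [Function.Injective, not_forall] at hinj
    obtain ⟨i, j, hij, hne⟩ := hinj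
    have h1 := hanti (Equiv.swap i j) m
    have h2 : m ∘ Equiv.swap i j = m := by
      funext k
      simp only [Function.comp]
      rcases eq_or_ne k i with rfl | hki
      · rw [Equiv.swap_apply_left, hij]
      · rcases eq_or_ne k j with rfl | hkj
        · rw [Equiv.swap_apply_right, hij]
        · rw [Equiv.swap_apply_of_ne_of_ne hki hkj]
    rw [h2, Equiv.Perm.sign_swap hne] at h1
    push_cast at h1
    linear_combination (1 / 2 : ℂ) * h1
  have hc : IsSubexponential fun p : Parts n => a (p.1 + delta n) := by
    -- Absolute convergence at the diagonal point (R, …, R) is exactly the required growth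
    -- condition.
    intro R hR0 hR
    have h1 := (ha _ (const_mem_polydisc hR0 hR)).summable.norm.comp_injective
      (injective_add_delta n)
    refine h1.congr fun p => ?_
    simp only [Function.comp, norm_mul, norm_pow, Complex.norm_real,
      Real.norm_of_nonneg hR0, Finset.prod_pow_eq_pow_sum]
    rfl
  refine ⟨_, hc, ?_⟩
  have hkey : ∀ z ∈ polydisc n, jac z * g (symMap z) =
      jac z * schurSum (fun p : Parts n => a (p.1 + delta n)) (symMap z) := by
    intro z hz
    rw [← hc.tsum_alternantTerm hz]
    have h1 := ha z hz
    rw [← (alternantExp_injective n).hasSum_iff (fun m hm => by rw [hzero m hm, zero_mul])] at h1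
    rw [← h1.tsum_eq]
    refine tsum_congr fun x => ?_
    simp only [alternantTerm, Function.comp_apply]
    congr 1
    exact hanti x.2 (x.1.1 + delta n)
  have heq : EqOn (g ∘ symMap)
      (schurSum (fun p : Parts n => a (p.1 + delta n)) ∘ symMap) (polydisc n) := by
    have hd : polydisc n ⊆ closure (polydisc n ∩ {z | jac z ≠ 0}) :=
      (dense_jac_ne_zero n).open_subset_closure_inter (isOpen_polydisc n)
    refine EqOn.of_subset_closure (s := polydisc n ∩ {z | jac z ≠ 0}) ?_
      (hg.continuousOn.comp continuous_symMap.continuousOn hmaps)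
      (hc.differentiableOn.continuousOn.comp continuous_symMap.continuousOn hmaps)
      inter_subset_left hd
    rintro z ⟨hz, hz'⟩
    exact mul_left_cancel₀ hz' (hkey z hz)
  rintro _ ⟨z, hz, rfl⟩
  exact heq hz

/-! ### The Bergman norm -/

theorem integrable_betaPDFReal {α β : ℝ} (hα : 0 < α) (hβ : 0 < β) :
    Integrable (ProbabilityTheory.betaPDFReal α β) ∧
      ∫ x, ProbabilityTheory.betaPDFReal α β x = 1 := by
  have h0 : ∀ x, 0 ≤ ProbabilityTheory.betaPDFReal α β x := by
    intro x
    by_cases h : 0 < x ∧ x < 1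
    · exact (ProbabilityTheory.betaPDFReal_pos h.1 h.2 hα hβ).le
    · rw [ProbabilityTheory.betaPDFReal, if_neg h]
  have h1 := ProbabilityTheory.lintegral_betaPDF_eq_one hα hβ
  simp only [ProbabilityTheory.betaPDF] at h1
  have hm := (ProbabilityTheory.measurable_betaPDFReal α β).aestronglyMeasurable (μ := volume)
  constructor
  · refine (lintegral_ofReal_ne_top_iff_integrable hm (ae_of_all _ h0)).mp ?_
    rw [h1]; exact ENNReal.one_ne_top
  · rw [integral_eq_lintegral_of_nonneg_ae (ae_of_all _ h0) hm, h1, ENNReal.toReal_one]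

/-- The density of the weighted Bergman measure of the disc, times `|x|^(2k)`. -/
noncomputable def diskWeight (μ : ℝ) (k : ℕ) (x : ℂ) : ℝ :=
  if ‖x‖ < 1 then (μ - 1) / Real.pi * (1 - ‖x‖ ^ 2) ^ (μ - 2) * ‖x‖ ^ (2 * k) else 0

theorem diskWeight_nonneg {μ : ℝ} (hμ : 1 < μ) (k : ℕ) (x : ℂ) : 0 ≤ diskWeight μ k x := by
  unfold diskWeight
  split_ifs with h
  · have h1 : ‖x‖ ^ 2 ≤ 1 := pow_le_one₀ (norm_nonneg _) h.le
    have := Real.rpow_nonneg (sub_nonneg.mpr h1) (μ - 2)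
    have := Real.pi_pos
    have : 0 < μ - 1 := sub_pos.mpr hμ
    positivity
  · exact le_rfl

theorem Gamma_add_nat {μ : ℝ} (hμ : 0 < μ) (k : ℕ) :
    Real.Gamma (μ + k) = (ascPochhammer ℝ k).eval μ * Real.Gamma μ := by
  induction k with
  | zero => simp
  | succ k ih =>
    rw [Nat.cast_succ, ← add_assoc, Real.Gamma_add_one (by positivity), ih,
      ascPochhammer_succ_eval]
    ring

theorem sub_one_mul_beta {μ : ℝ} (hμ : 1 < μ) (k : ℕ) :
    (μ - 1) * ProbabilityTheory.beta (k + 1) (μ - 1) =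
      (k.factorial : ℝ) / (ascPochhammer ℝ k).eval μ := by
  have h1 : 0 < μ - 1 := sub_pos.mpr hμ
  have h2 : Real.Gamma μ = (μ - 1) * Real.Gamma (μ - 1) := by
    rw [← Real.Gamma_add_one h1.ne', sub_add_cancel]
  have h3 : ((k : ℝ) + 1 + (μ - 1)) = μ + k := by ring
  have h4 := Real.Gamma_pos_of_pos h1
  have h5 := ascPochhammer_pos k μ (by linarith)
  rw [ProbabilityTheory.beta, Real.Gamma_nat_eq_factorial, h3, Gamma_add_nat (by linarith), h2]
  field_simp

/-- Polar coordinates and t = r² reduce this to the Beta integral B(k+1, μ-1), which converges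
because μ > 1. -/
theorem integral_diskWeight {μ : ℝ} (hμ : 1 < μ) (k : ℕ) :
    Integrable (diskWeight μ k) ∧
      ∫ x, diskWeight μ k x = (k.factorial : ℝ) / (ascPochhammer ℝ k).eval μ := by
  have hα : (0 : ℝ) < k + 1 := by positivity
  have hβ : 0 < μ - 1 := sub_pos.mpr hμ
  obtain ⟨hi, hint⟩ := integrable_betaPDFReal hα hβ
  have hb := ProbabilityTheory.beta_pos hα hβ
  have hsupp : ∫ x in Ioi 0, ProbabilityTheory.betaPDFReal (k + 1) (μ - 1) x = 1 := by
    refine (setIntegral_eq_integral_of_forall_compl_eq_zero fun x hx => ?_).trans hint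
    rw [ProbabilityTheory.betaPDFReal, if_neg fun h => hx h.1]
  -- B undoes the normalization of the Beta density and absorbs the factor 2 from dt = 2r dr,
  -- leaving the radial density to be multiplied by the circumference factor 2π.
  set B : ℝ := (μ - 1) * ProbabilityTheory.beta (k + 1) (μ - 1) / (2 * Real.pi) with hB
  let g : ℝ → ℝ := fun t => B * ProbabilityTheory.betaPDFReal (k + 1) (μ - 1) t
  let φ : ℝ → ℝ := fun y =>
    if y < 1 then (μ - 1) / Real.pi * (1 - y ^ 2) ^ (μ - 2) * y ^ (2 * k) else 0
  have hφg : EqOn (fun y : ℝ => y ^ (Module.finrank ℝ ℂ - 1) • φ y)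
      (fun y : ℝ => (2 * y ^ ((2 : ℝ) - 1)) • g (y ^ (2 : ℝ))) (Ioi 0) := by
    intro y hy
    have hy0 : 0 < y := hy
    have hy2 : y ^ (2 : ℝ) = y ^ 2 := by exact_mod_cast Real.rpow_natCast y 2
    have hlt : (0 < y ^ 2 ∧ y ^ 2 < 1) ↔ y < 1 := by
      rw [and_iff_right (by positivity)]
      exact pow_lt_one_iff_of_nonneg hy0.le two_ne_zero
    have hpi := Real.pi_pos.ne'
    simp only [g, φ, Complex.finrank_real_complex, smul_eq_mul, hy2,
      ProbabilityTheory.betaPDFReal, hlt]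
    rw [show (2 : ℝ) - 1 = 1 by norm_num, Real.rpow_one, show 2 - 1 = 1 by norm_num, pow_one]
    split_ifs with h
    · rw [hB, add_sub_cancel_right, Real.rpow_natCast, ← pow_mul, show μ - 1 - 1 = μ - 2 by ring]
      field_simp
    · simp
  have hd : diskWeight μ k = fun x => φ ‖x‖ := rfl
  rw [hd]
  constructor
  · rw [integrable_fun_norm_addHaar (volume : Measure ℂ) (f := φ), integrableOn_congr_fun hφg measurableSet_Ioi]
    have := (integrableOn_Ioi_comp_rpow_iff g (p := 2) two_ne_zero).mpr (hi.const_mul B).integrableOn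
    rwa [abs_two] at this
  · rw [integral_fun_norm_addHaar (volume : Measure ℂ) φ, setIntegral_congr_fun measurableSet_Ioi hφg,
      integral_comp_rpow_Ioi_of_pos two_pos, integral_const_mul, hsupp, ← sub_one_mul_beta hμ,
      Complex.finrank_real_complex, Measure.real, Complex.volume_ball]
    simp only [nsmul_eq_mul, smul_eq_mul, hB]
    simp
    have hpi := Real.pi_pos.ne'
    field_simp

theorem lintegral_prod_diskWeight {n : ℕ} {μ : ℝ} (hμ : 1 < μ) (m : Fin n → ℕ) :
    ∫⁻ z : Fin n → ℂ, ENNReal.ofReal (∏ i, diskWeight μ (m i) (z i)) =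
      ENNReal.ofReal (∏ i, ((m i).factorial : ℝ) / (ascPochhammer ℝ (m i)).eval μ) := by
  have hi : Integrable (fun z : Fin n → ℂ => ∏ i, diskWeight μ (m i) (z i)) :=
    Integrable.fintype_prod (μ := fun _ => volume) fun i => (integral_diskWeight hμ (m i)).1
  rw [← ofReal_integral_eq_lintegral_ofReal hi
    (ae_of_all _ fun z => Finset.prod_nonneg fun i _ => diskWeight_nonneg hμ _ _),
    integral_fintype_prod_volume_eq_prod]
  congr 1
  exact Finset.prod_congr rfl fun i _ => (integral_diskWeight hμ (m i)).2

theorem measurable_diskWeight (μ : ℝ) (k : ℕ) : Measurable (diskWeight μ k) := by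
  unfold diskWeight
  exact Measurable.ite (measurableSet_lt measurable_norm measurable_const) (by fun_prop)
    measurable_const

theorem measurePreserving_rotate {n : ℕ} (θ : Fin n → ℝ) :
    MeasurePreserving (rotate (n := n) θ) := by
  have h := volume_preserving_pi (ι := Fin n)
    (f := fun i => rotation (Circle.exp (θ i))) fun i =>
      LinearIsometryEquiv.measurePreserving _
  convert h using 1
  funext z i
  simp [rotate, Circle.coe_exp]

theorem continuous_rotate (n : ℕ) :
    Continuous fun x : (Fin n → ℝ) × (Fin n → ℂ) => rotate x.1 x.2 := by
  unfold rotate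
  fun_prop

theorem diskWeight_rotate {n : ℕ} (μ : ℝ) (k : ℕ) (θ : Fin n → ℝ) (z : Fin n → ℂ) (i : Fin n) :
    diskWeight μ k (rotate θ z i) = diskWeight μ k (z i) := by
  simp [diskWeight, rotate, Complex.norm_exp_ofReal_mul_I]

/-- Averaging an integral against a rotation invariant weight over the torus. -/
theorem lintegral_mul_eq_lintegral_rotate {n : ℕ} {W G : (Fin n → ℂ) → ℝ≥0∞} (hW : Measurable W)
    (hG : Measurable G) (hWr : ∀ θ z, W (rotate θ z) = W z) :
    ENNReal.ofReal ((2 * Real.pi) ^ n) * ∫⁻ z, W z * G z =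
      ∫⁻ z, W z * ∫⁻ θ in Icc (0 : Fin n → ℝ) (fun _ => 2 * Real.pi), G (rotate θ z) := by
  have hvol : volume (Icc (0 : Fin n → ℝ) (fun _ => 2 * Real.pi)) =
      ENNReal.ofReal ((2 * Real.pi) ^ n) := by
    rw [Real.volume_Icc_pi]
    simp [ENNReal.ofReal_pow Real.two_pi_pos.le]
  have h1 : ∀ θ : Fin n → ℝ, ∫⁻ z, W z * G (rotate θ z) = ∫⁻ z, W z * G z := by
    intro θ
    have := (measurePreserving_rotate θ).lintegral_comp (hW.mul hG)
    simpa only [Pi.mul_apply, hWr] using this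
  have hGr : Measurable fun x : (Fin n → ℝ) × (Fin n → ℂ) => G (rotate x.1 x.2) :=
    hG.comp (continuous_rotate n).measurable
  calc ENNReal.ofReal ((2 * Real.pi) ^ n) * ∫⁻ z, W z * G z
      = ∫⁻ θ in Icc (0 : Fin n → ℝ) (fun _ => 2 * Real.pi), ∫⁻ z, W z * G (rotate θ z) := by
        simp_rw [h1]
        rw [setLIntegral_const, hvol, mul_comm]
    _ = ∫⁻ z, ∫⁻ θ in Icc (0 : Fin n → ℝ) (fun _ => 2 * Real.pi), W z * G (rotate θ z) :=
        lintegral_lintegral_swap ((hW.comp measurable_snd).mul hGr).aemeasurable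
    _ = _ := by
        refine lintegral_congr fun z => ?_
        exact lintegral_const_mul (W z) (hGr.comp measurable_prodMk_right)

theorem prod_diskWeight_mul {n : ℕ} {μ : ℝ} (hμ : 1 < μ) (c : Parts n → ℂ) (z : Fin n → ℂ)
    (x : Parts n × Equiv.Perm (Fin n)) :
    ENNReal.ofReal (∏ i, diskWeight μ 0 (z i)) * ‖alternantTerm c z x‖ₑ ^ 2 =
      ‖c x.1‖ₑ ^ 2 * ENNReal.ofReal (∏ i, diskWeight μ (alternantExp x i) (z i)) := by
  have h0 : ∀ i, diskWeight μ (alternantExp x i) (z i) =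
      diskWeight μ 0 (z i) * (‖z i‖ ^ alternantExp x i) ^ 2 := by
    intro i
    unfold diskWeight
    split_ifs
    · rw [mul_zero, pow_zero, mul_one, ← pow_mul, mul_comm 2]
    · rw [zero_mul]
  simp_rw [h0]
  rw [Finset.prod_mul_distrib, Finset.prod_pow, ← ofReal_norm, norm_alternantTerm, ← ofReal_norm,
    ← ENNReal.ofReal_pow (by positivity), ← ENNReal.ofReal_pow (by positivity),
    ← ENNReal.ofReal_mul (Finset.prod_nonneg fun i _ => diskWeight_nonneg hμ _ _),
    ← ENNReal.ofReal_mul (by positivity)]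
  congr 1
  ring

/-- Transfers the norm to Lebesgue measure on ℂⁿ, where rotations act. The indicator is needed
because `g` is uncontrolled outside 𝔾ₙ. -/
theorem bergmanNormSq_eq_lintegral {n : ℕ} {μ : ℝ} {g : (Fin n → ℂ) → ℂ}
    (hg : ContinuousOn g (symPolydisc n)) :
    bergmanNormSq μ (fun u : symPolydisc n => g u) =
      ENNReal.ofReal (1 / n.factorial) * ∫⁻ z, ENNReal.ofReal (∏ i, diskWeight μ 0 (z i)) *
        ‖(polydisc n).indicator (fun z => jac z * g (symMap z)) z‖ₑ ^ 2 := by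
  have hmeas : MeasurableSet (polydisc n) := (isOpen_polydisc n).measurableSet
  have hgm : Measurable fun u : symPolydisc n => ‖g u‖ₑ ^ 2 := by
    have : Continuous fun u : symPolydisc n => g u := continuousOn_iff_continuous_domRestrict.mp hg
    exact (this.measurable.enorm).pow_const 2
  have hsm : Measurable (symMapOn n) :=
    (Measurable.subtype_mk (continuous_symMap.measurable.comp measurable_subtype_coe))
  have hjm : Measurable fun z : polydisc n =>
      ENNReal.ofReal (‖jac (z : Fin n → ℂ)‖ ^ 2 / (n.factorial : ℝ)) := by
    have := (continuous_jac (n := n)).measurable.comp (measurable_subtype_coe (p := (· ∈ polydisc n)))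
    exact ENNReal.measurable_ofReal.comp ((this.norm.pow_const 2).div_const _)
  have hwm : Measurable fun z : polydisc n =>
      ENNReal.ofReal (((μ - 1) / Real.pi) ^ n *
        ∏ i, (1 - ‖(z : Fin n → ℂ) i‖ ^ 2) ^ (μ - 2)) := by
    refine ENNReal.measurable_ofReal.comp (measurable_const.mul
      (Finset.measurable_fun_prod _ fun i _ => ?_))
    have : Measurable fun z : polydisc n => (z : Fin n → ℂ) i :=
      (measurable_pi_apply i).comp measurable_subtype_coe
    exact (measurable_const.sub (this.norm.pow_const 2)).pow_const _
  rw [bergmanNormSq, symMeasure, lintegral_map hgm hsm,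
    lintegral_withDensity_eq_lintegral_mul _ hjm
      (show Measurable fun z => ‖g (symMapOn n z)‖ₑ ^ 2 from hgm.comp hsm), polydiscMeasure,
    lintegral_withDensity_eq_lintegral_mul _ hwm
      (hjm.mul (show Measurable fun z => ‖g (symMapOn n z)‖ₑ ^ 2 from hgm.comp hsm)),
    ← lintegral_const_mul' _ _ ENNReal.ofReal_ne_top]
  have hind : ∀ z : Fin n → ℂ, ENNReal.ofReal (1 / n.factorial) *
      (ENNReal.ofReal (∏ i, diskWeight μ 0 (z i)) *
        ‖(polydisc n).indicator (fun z => jac z * g (symMap z)) z‖ₑ ^ 2) =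
      (polydisc n).indicator (fun z => ENNReal.ofReal (((μ - 1) / Real.pi) ^ n *
        ∏ i, (1 - ‖z i‖ ^ 2) ^ (μ - 2)) * (ENNReal.ofReal (‖jac z‖ ^ 2 / (n.factorial : ℝ)) *
          ‖g (symMap z)‖ₑ ^ 2)) z := by
    intro z
    by_cases hz : z ∈ polydisc n
    · rw [indicator_of_mem hz, indicator_of_mem hz]
      have h1 : ∏ i, diskWeight μ 0 (z i) =
          ((μ - 1) / Real.pi) ^ n * ∏ i, (1 - ‖z i‖ ^ 2) ^ (μ - 2) := by
        rw [← Fin.prod_const n, ← Finset.prod_mul_distrib]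
        refine Finset.prod_congr rfl fun i _ => ?_
        rw [diskWeight, if_pos (hz i), mul_zero, pow_zero, mul_one]
      rw [h1, mul_left_comm, enorm_mul, mul_pow, ← mul_assoc (ENNReal.ofReal (1 / n.factorial)),
        ← ofReal_norm (jac z), ← ENNReal.ofReal_pow (norm_nonneg _),
        ← ENNReal.ofReal_mul (by positivity), one_div_mul_eq_div]
    · rw [indicator_of_notMem hz, indicator_of_notMem hz]
      simp
  simp_rw [hind]
  rw [lintegral_indicator hmeas, ← lintegral_subtype_comap hmeas]
  rfl

/-- Averaging over rotations replaces the integrand, by Parseval at each z, with a sum of squared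
monomials. Each integrates to a product of disc moments, the same value 1/γ_𝐩² for all n!
permutations, which cancels the factor 1/n!. -/
theorem IsSubexponential.bergmanNormSq_eq {n : ℕ} {μ : ℝ} (hμ : 1 < μ) {c : Parts n → ℂ}
    (hc : IsSubexponential c) :
    bergmanNormSq μ (fun u : symPolydisc n => schurSum c u) =
      ∑' p, ENNReal.ofReal (1 / gammaSq μ p) * ‖c p‖ₑ ^ 2 := by
  have hcont := hc.differentiableOn.continuousOn
  have hmaps : MapsTo symMap (polydisc n) (symPolydisc n) := fun z hz => mem_image_of_mem _ hz
  rw [bergmanNormSq_eq_lintegral hcont]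
  set W : (Fin n → ℂ) → ℝ≥0∞ := fun z => ENNReal.ofReal (∏ i, diskWeight μ 0 (z i)) with hW
  set G : (Fin n → ℂ) → ℝ≥0∞ := fun z =>
    ‖(polydisc n).indicator (fun z => jac z * schurSum c (symMap z)) z‖ₑ ^ 2 with hG
  have hWm : Measurable W := ENNReal.measurable_ofReal.comp
    (Finset.measurable_fun_prod _ fun i _ =>
      (measurable_diskWeight μ 0).comp (measurable_pi_apply i))
  have hGm : Measurable G := by
    have h1 : ContinuousOn (fun z => jac z * schurSum c (symMap z)) (polydisc n) :=
      continuous_jac.continuousOn.mul (hcont.comp continuous_symMap.continuousOn hmaps)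
    have h2 : Measurable ((polydisc n).indicator fun z => jac z * schurSum c (symMap z)) := by
      classical
      have := h1.measurable_piecewise (g := fun _ => 0) continuousOn_const
        (isOpen_polydisc n).measurableSet
      rwa [show (fun _ : Fin n → ℂ => (0 : ℂ)) = 0 from rfl, piecewise_eq_indicator] at this
    exact h2.enorm.pow_const 2
  have hrot := lintegral_mul_eq_lintegral_rotate hWm hGm fun θ z => by
    simp only [hW, diskWeight_rotate]
  have hinner : ∀ z, W z * ∫⁻ θ in Icc (0 : Fin n → ℝ) (fun _ => 2 * Real.pi), G (rotate θ z) =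
      ENNReal.ofReal ((2 * Real.pi) ^ n) * ∑' x, ‖c x.1‖ₑ ^ 2 *
        ENNReal.ofReal (∏ i, diskWeight μ (alternantExp x i) (z i)) := by
    intro z
    simp_rw [← prod_diskWeight_mul hμ]
    rw [ENNReal.tsum_mul_left]
    by_cases hz : z ∈ polydisc n
    · rw [mul_left_comm, ← hc.lintegral_rotate hz]
      congr 1
      refine lintegral_congr fun θ => ?_
      simp only [hG]
      rw [indicator_of_mem ((rotate_mem_polydisc θ z).mpr hz)]
    -- Outside the polydisc Parseval is unavailable, but the weight vanishes.
    · have : W z = 0 := by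
        obtain ⟨i, hi⟩ := not_forall.mp hz
        simp only [hW]
        rw [Finset.prod_eq_zero (Finset.mem_univ i) (by rw [diskWeight, if_neg hi]),
          ENNReal.ofReal_zero]
      simp only [hW] at this
      simp only [this, zero_mul, mul_zero, W]
  simp_rw [hinner] at hrot
  rw [lintegral_const_mul' _ _ ENNReal.ofReal_ne_top,
    ENNReal.mul_right_inj (by rw [ne_eq, ENNReal.ofReal_eq_zero, not_le]; positivity)
      ENNReal.ofReal_ne_top, lintegral_tsum] at hrot
  · rw [hrot]
    have hterm : ∀ x : Parts n × Equiv.Perm (Fin n), ∫⁻ z : Fin n → ℂ, ‖c x.1‖ₑ ^ 2 *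
        ENNReal.ofReal (∏ i, diskWeight μ (alternantExp x i) (z i)) =
        ENNReal.ofReal (1 / gammaSq μ x.1) * ‖c x.1‖ₑ ^ 2 := by
      intro x
      rw [lintegral_const_mul' _ _ (by simp), lintegral_prod_diskWeight hμ, mul_comm]
      congr 2
      rw [gammaSq_eq_prod, one_div, ← Finset.prod_inv_distrib]
      simp only [inv_div]
      exact Equiv.prod_comp x.2 fun i => (((x.1.1 + delta n) i).factorial : ℝ) /
        (ascPochhammer ℝ ((x.1.1 + delta n) i)).eval μ
    simp_rw [hterm]
    rw [ENNReal.tsum_prod', ← ENNReal.tsum_mul_left]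
    refine tsum_congr fun p => ?_
    simp only [tsum_fintype, Finset.sum_const, Finset.card_univ, Fintype.card_perm,
      Fintype.card_fin, nsmul_eq_mul]
    rw [← mul_assoc, ← ENNReal.ofReal_natCast, ← ENNReal.ofReal_mul (by positivity),
      one_div_mul_cancel (by positivity), ENNReal.ofReal_one, one_mul]
  · intro x
    refine (measurable_const.mul (ENNReal.measurable_ofReal.comp
      (Finset.measurable_fun_prod _ fun i _ =>
        (measurable_diskWeight μ _).comp (measurable_pi_apply i)))).aemeasurable

/-! ### The model of the weighted Bergman spaces -/

/-- The Hilbert space of the square summable families of coefficients with respect to the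
orthonormal basis `γ_𝐩 S_𝐩`. -/
abbrev CoeffSpace (n : ℕ) : Type := lp (fun _ : Parts n => ℂ) 2

theorem lp_two_hasSum_norm_sq {ι : Type*} (x : lp (fun _ : ι => ℂ) 2) :
    HasSum (fun i => ‖x i‖ ^ 2) (‖x‖ ^ 2) := by
  have h := lp.hasSum_norm (p := 2) (by norm_num) x
  simpa using h

theorem memℓp_two_of_summable {ι : Type*} {x : ι → ℂ} (h : Summable fun i => ‖x i‖ ^ 2) :
    Memℓp x 2 :=
  memℓp_gen (by simpa using h)

theorem enorm_sq_lp {ι : Type*} (x : lp (fun _ : ι => ℂ) 2) :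
    ‖x‖ₑ ^ 2 = ∑' i, ‖x i‖ₑ ^ 2 := by
  have h := lp_two_hasSum_norm_sq x
  rw [← ofReal_norm, ← ENNReal.ofReal_pow (norm_nonneg _), ← h.tsum_eq,
    ENNReal.ofReal_tsum_of_nonneg (fun _ => by positivity) h.summable]
  refine tsum_congr fun i => ?_
  rw [← ofReal_norm, ← ENNReal.ofReal_pow (norm_nonneg _)]

/-- The coefficients with respect to the Schur polynomials of an element of the model. -/
noncomputable def schurCoeff {n : ℕ} (μ : ℝ) (x : Parts n → ℂ) (p : Parts n) : ℂ :=
  x p * (√(gammaSq μ p) : ℝ)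

theorem norm_schurCoeff_sq {n : ℕ} {μ : ℝ} (hμ : 0 < μ) (x : Parts n → ℂ) (p : Parts n) :
    ‖schurCoeff μ x p‖ ^ 2 = gammaSq μ p * ‖x p‖ ^ 2 := by
  rw [schurCoeff, norm_mul, mul_pow, Complex.norm_real, Real.norm_of_nonneg (Real.sqrt_nonneg _),
    Real.sq_sqrt (gammaSq_pos hμ p).le, mul_comm]

/-- By the inequality of arithmetic and geometric means, each term is at most |x_𝐩|² + γ_𝐩²
R^(2|𝐩+δ|), and both series converge. -/
theorem isSubexponential_schurCoeff {n : ℕ} {μ : ℝ} (hμ : 0 < μ) (x : CoeffSpace n) :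
    IsSubexponential (schurCoeff μ x) := by
  intro R hR0 hR
  have h1 := (lp_two_hasSum_norm_sq x).summable
  have h2 := summable_gammaSq_mul_pow (n := n) hμ (sq_nonneg R) (pow_lt_one₀ hR0 hR two_ne_zero)
  refine Summable.of_nonneg_of_le (fun p => by positivity) (fun p => ?_) (h1.add h2)
  have hs := Real.sq_sqrt (gammaSq_pos hμ p).le
  rw [schurCoeff, norm_mul, Complex.norm_real, Real.norm_of_nonneg (Real.sqrt_nonneg _), ← hs,
    ← pow_mul, mul_comm 2, pow_mul, ← mul_pow, Real.sqrt_sq (Real.sqrt_nonneg _), mul_assoc]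
  have h3 := two_mul_le_add_sq ‖x p‖ (√(gammaSq μ p) * R ^ degree p)
  have h4 : 0 ≤ ‖x p‖ * (√(gammaSq μ p) * R ^ degree p) := by positivity
  linarith

/-- The squared norm is the diagonal kernel value ∑ γ_𝐩² |S_𝐩(u)|². The conjugation compensates for
the inner product being conjugate linear in its first slot. -/
theorem memℓp_schurFeature {n : ℕ} {μ : ℝ} (hμ : 0 < μ) (u : symPolydisc n) :
    Memℓp (fun p : Parts n => conj ((√(gammaSq μ p) : ℝ) * giambelliDet p u : ℂ)) 2 := by
  refine memℓp_two_of_summable ?_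
  obtain ⟨R, hR0, hR, hu⟩ := exists_ball_of_mem_symPolydisc u.2
  obtain ⟨R', h1, h2⟩ := exists_between hR
  obtain ⟨C, hC0, hC⟩ := exists_norm_giambelliDet_le (n := n) hR0 h1
  have h3 := (summable_gammaSq_mul_pow (n := n) hμ (sq_nonneg R')
    (pow_lt_one₀ (hR0.trans h1.le) h2 two_ne_zero)).mul_left (C ^ 2)
  refine Summable.of_nonneg_of_le (fun p => by positivity) (fun p => ?_) h3
  rw [RCLike.norm_conj, norm_mul, mul_pow, Complex.norm_real,
    Real.norm_of_nonneg (Real.sqrt_nonneg _), Real.sq_sqrt (gammaSq_pos hμ p).le]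
  have h4 := pow_le_pow_left₀ (norm_nonneg _) (hC p u hu) 2
  rw [mul_pow, ← pow_mul, mul_comm (degree p), pow_mul] at h4
  calc gammaSq μ p * ‖giambelliDet p u‖ ^ 2
      ≤ gammaSq μ p * (C ^ 2 * (R' ^ 2) ^ degree p) :=
        mul_le_mul_of_nonneg_left h4 (gammaSq_pos hμ p).le
    _ = _ := by ring

/-- The kernel function at `u`. -/
noncomputable def schurFeature {n : ℕ} {μ : ℝ} (hμ : 0 < μ) (u : symPolydisc n) : CoeffSpace n :=
  ⟨_, memℓp_schurFeature hμ u⟩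

theorem inner_schurFeature {n : ℕ} {μ : ℝ} (hμ : 0 < μ) (u : symPolydisc n) (x : CoeffSpace n) :
    inner ℂ (schurFeature hμ u) x = schurSum (schurCoeff μ x) u := by
  rw [lp.inner_eq_tsum, schurSum]
  refine tsum_congr fun p => ?_
  simp only [schurFeature, RCLike.inner_apply, Complex.conj_conj, schurCoeff]
  ring

theorem hasSum_inner_schurFeature {n : ℕ} {μ : ℝ} (hμ : 0 < μ) (u v : symPolydisc n) :
    HasSum (fun p : Parts n => (gammaSq μ p : ℂ) * giambelliDet p (u : Fin n → ℂ) *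
      conj (giambelliDet p (v : Fin n → ℂ)))
      (inner ℂ (schurFeature hμ u) (schurFeature hμ v)) := by
  refine (lp.hasSum_inner (𝕜 := ℂ) (schurFeature hμ u) (schurFeature hμ v)).congr_fun fun p => ?_
  have hs : ((√(gammaSq μ p) : ℝ) : ℂ) * (√(gammaSq μ p) : ℝ) = (gammaSq μ p : ℂ) := by
    rw [← Complex.ofReal_mul, Real.mul_self_sqrt (gammaSq_pos hμ p).le]
  simp only [schurFeature, RCLike.inner_apply, Complex.conj_conj, map_mul, Complex.conj_ofReal]
  rw [← hs]
  ring

/-- The model of the weighted Bergman space, as a space of functions on the symmetrized polydisc. -/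
def SchurSpace (n : ℕ) {μ : ℝ} (_ : 0 < μ) : Type := CoeffSpace n

section

variable {n : ℕ} {μ : ℝ} (hμ : 0 < μ)

noncomputable instance : NormedAddCommGroup (SchurSpace n hμ) :=
  inferInstanceAs (NormedAddCommGroup (CoeffSpace n))

noncomputable instance : InnerProductSpace ℂ (SchurSpace n hμ) :=
  inferInstanceAs (InnerProductSpace ℂ (CoeffSpace n))

instance : CompleteSpace (SchurSpace n hμ) :=
  inferInstanceAs (CompleteSpace (CoeffSpace n))

/-- The evaluation map of the model. -/
noncomputable def schurEval : CoeffSpace n →L[ℂ] symPolydisc n → ℂ :=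
  ContinuousLinearMap.pi fun u => innerSL ℂ (schurFeature hμ u)

theorem schurEval_apply (x : CoeffSpace n) :
    schurEval hμ x = fun u : symPolydisc n => schurSum (schurCoeff μ x) u := by
  funext u
  exact inner_schurFeature hμ u x

theorem schurEval_injective : Function.Injective (schurEval (n := n) hμ) := by
  refine (injective_iff_map_eq_zero _).mpr fun x hx => ?_
  rw [schurEval_apply] at hx
  have h1 := (isSubexponential_schurCoeff hμ x).eq_zero fun u hu => congrFun hx ⟨u, hu⟩
  ext p
  have h3 : ((√(gammaSq μ p) : ℝ) : ℂ) ≠ 0 := by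
    exact_mod_cast (Real.sqrt_pos.mpr (gammaSq_pos hμ p)).ne'
  exact (mul_eq_zero.mp (congrFun h1 p)).resolve_right h3

noncomputable instance : RKHS ℂ (SchurSpace n hμ) (symPolydisc n) ℂ where
  coeCLM := schurEval hμ
  coeCLM_injective := schurEval_injective hμ

theorem SchurSpace.coe_eq (x : CoeffSpace n) :
    (⇑(show SchurSpace n hμ from x) : symPolydisc n → ℂ) =
      fun u : symPolydisc n => schurSum (schurCoeff μ x) u :=
  schurEval_apply hμ x

theorem scalarKernel_eq_of_inner {X H : Type*} [NormedAddCommGroup H] [InnerProductSpace ℂ H]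
    [CompleteSpace H] [RKHS ℂ H X ℂ] {k : H} {v : X} (hk : ∀ f : H, inner ℂ k f = f v) (u : X) :
    scalarKernel H u v = k u := by
  have : RKHS.kerFun H v 1 = k := by
    refine ext_inner_right ℂ fun f => ?_
    rw [hk, RKHS.kerFun_inner]
    simp
  rw [scalarKernel, ← RKHS.kerFun_apply, this]

theorem scalarKernel_schurSpace (u v : symPolydisc n) :
    scalarKernel (SchurSpace n hμ) u v = inner ℂ (schurFeature hμ u) (schurFeature hμ v) :=
  scalarKernel_eq_of_inner (k := (show SchurSpace n hμ from schurFeature hμ v)) (fun _ => rfl) u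

theorem enorm_schurCoeff_sq {n : ℕ} {μ : ℝ} (hμ : 0 < μ) (x : Parts n → ℂ) (p : Parts n) :
    ENNReal.ofReal (1 / gammaSq μ p) * ‖schurCoeff μ x p‖ₑ ^ 2 = ‖x p‖ₑ ^ 2 := by
  have h := gammaSq_pos hμ p
  rw [← ofReal_norm, ← ENNReal.ofReal_pow (norm_nonneg _), norm_schurCoeff_sq hμ,
    ← ENNReal.ofReal_mul (by positivity), ← ofReal_norm, ← ENNReal.ofReal_pow (norm_nonneg _)]
  congr 1
  field_simp

/-- If a functional agrees on the Schur series with the weighted sum of squares of the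
coefficients, then the model consists of the holomorphic functions at which it is finite. -/
theorem schurSpace_characterization {N : (symPolydisc n → ℂ) → ℝ≥0∞}
    (hN : ∀ c : Parts n → ℂ, IsSubexponential c →
      N (fun u : symPolydisc n => schurSum c u) =
        ∑' p, ENNReal.ofReal (1 / gammaSq μ p) * ‖c p‖ₑ ^ 2) :
    (∀ f : symPolydisc n → ℂ, (∃ h : SchurSpace n hμ, ⇑h = f) ↔ IsHolomorphic f ∧ N f < ∞) ∧
    ∀ h : SchurSpace n hμ, ‖h‖ₑ ^ 2 = N ⇑h := by
  have hnorm : ∀ h : SchurSpace n hμ, ‖h‖ₑ ^ 2 = N ⇑h := by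
    intro h
    refine (enorm_sq_lp (show CoeffSpace n from h)).trans ?_
    rw [SchurSpace.coe_eq hμ h, hN _ (isSubexponential_schurCoeff hμ h)]
    exact tsum_congr fun p => (enorm_schurCoeff_sq hμ _ p).symm
  refine ⟨fun f => ⟨?_, ?_⟩, hnorm⟩
  · rintro ⟨h, rfl⟩
    refine ⟨⟨schurSum (schurCoeff μ (show CoeffSpace n from h)),
      (isSubexponential_schurCoeff hμ h).differentiableOn,
      fun u => congrFun (SchurSpace.coe_eq hμ h) u⟩, ?_⟩
    rw [← hnorm]
    exact ENNReal.pow_lt_top enorm_lt_top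
  · rintro ⟨⟨g, hg, hfg⟩, hfin⟩
    obtain ⟨c, hc, hgc⟩ := exists_eq_schurSum hg
    have hf : f = fun u : symPolydisc n => schurSum c u := funext fun u => by
      rw [hfg, hgc u u.2]
    rw [hf, hN c hc] at hfin
    -- Dividing by γ_𝐩 passes to coordinates in the orthonormal basis; finiteness of N f says that
    -- these are square summable.
    have hcx : schurCoeff μ (fun p => c p / (√(gammaSq μ p) : ℝ)) = c := by
      funext p
      have h3 : ((√(gammaSq μ p) : ℝ) : ℂ) ≠ 0 := by
        exact_mod_cast (Real.sqrt_pos.mpr (gammaSq_pos hμ p)).ne'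
      rw [schurCoeff, div_mul_cancel₀ _ h3]
    have hmem : Memℓp (fun p => c p / ((√(gammaSq μ p) : ℝ) : ℂ)) 2 := by
      refine memℓp_two_of_summable ?_
      rw [← hcx] at hfin
      simp only [enorm_schurCoeff_sq hμ] at hfin
      have h4 := ENNReal.summable_toReal hfin.ne
      refine h4.congr fun p => ?_
      rw [ENNReal.toReal_pow, toReal_enorm]
    refine ⟨(⟨_, hmem⟩ : CoeffSpace n), ?_⟩
    rw [hf]
    refine (SchurSpace.coe_eq hμ _).trans (funext fun u => ?_)
    exact congrArg (fun c => schurSum c (u : Fin n → ℂ)) hcx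

theorem gammaSq_one (p : Parts n) : gammaSq 1 p = 1 := by
  rw [gammaSq_eq_prod]
  refine Finset.prod_eq_one fun j _ => ?_
  rw [ascPochhammer_eval_one, div_self (by positivity)]

theorem schurSeries_eq_inner (z w : polydisc n) :
    schurSeries μ z w =
      inner ℂ (schurFeature hμ (symMapOn n z)) (schurFeature hμ (symMapOn n w)) := by
  rw [← (hasSum_inner_schurFeature hμ _ _).tsum_eq, schurSeries]
  simp only [eval_schur]
  rfl

theorem isWeightedBergmanSpace_schurSpace : IsWeightedBergmanSpace n μ (SchurSpace n hμ) := by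
  refine ⟨fun h => ?_, fun h => ?_, fun h => ⟨fun x => ?_, fun z w => ?_⟩⟩
  · exact schurSpace_characterization hμ fun c hc => hc.bergmanNormSq_eq h
  · subst h
    refine schurSpace_characterization hμ fun c hc => ?_
    rw [hc.hardyNormSq_eq]
    simp [gammaSq_one]
  · exact ⟨schurSum (schurCoeff μ (show CoeffSpace n from x)), (isSubexponential_schurCoeff hμ x).differentiableOn,
      fun u => congrFun (SchurSpace.coe_eq hμ x) u⟩
  · rw [scalarKernel_schurSpace hμ, schurSeries_eq_inner hμ]

/-- A reproducing kernel is determined by the functions of its Hilbert space and their norms. -/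
theorem scalarKernel_eq_of_norm_eq {X H₁ H₂ : Type*} [NormedAddCommGroup H₁]
    [InnerProductSpace ℂ H₁] [CompleteSpace H₁] [RKHS ℂ H₁ X ℂ] [NormedAddCommGroup H₂]
    [InnerProductSpace ℂ H₂] [CompleteSpace H₂] [RKHS ℂ H₂ X ℂ]
    (h₁₂ : ∀ f : H₁, ∃ g : H₂, (⇑g : X → ℂ) = ⇑f) (h₂₁ : ∀ g : H₂, ∃ f : H₁, (⇑f : X → ℂ) = ⇑g)
    (hnorm : ∀ (f : H₁) (g : H₂), (⇑f : X → ℂ) = ⇑g → ‖f‖ = ‖g‖) (u v : X) :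
    scalarKernel H₁ u v = scalarKernel H₂ u v := by
  -- Elements are determined by their functions, so matching functions is automatically linear, and
  -- it preserves norms by `hnorm`. A linear isometry preserves inner products and so carries the
  -- reproducing property across.
  choose T hT using h₁₂
  let L : H₁ →ₗᵢ[ℂ] H₂ :=
    { toFun := T
      map_add' := fun f g => DFunLike.coe_injective (by simp [hT])
      map_smul' := fun a f => DFunLike.coe_injective (by simp [hT])
      norm_map' := fun f => (hnorm f (T f) (hT f).symm).symm }
  obtain ⟨k, hk⟩ := h₂₁ (RKHS.kerFun H₂ v 1)
  have hLk : L k = RKHS.kerFun H₂ v 1 := DFunLike.coe_injective ((hT k).trans hk)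
  rw [scalarKernel_eq_of_inner (k := k) (fun f => ?_) u, hk, scalarKernel, ← RKHS.kerFun_apply]
  rw [← L.inner_map_map, hLk, RKHS.kerFun_inner, show (L f : X → ℂ) v = f v from congrFun (hT f) v]
  simp

/-- For μ ≥ 1 the functions and norms are prescribed, so comparison with the model fixes the kernel;
for μ < 1 the kernel itself is prescribed. -/
theorem scalarKernel_eq_inner_schurFeature {H : Type*} [NormedAddCommGroup H]
    [InnerProductSpace ℂ H] [CompleteSpace H] [RKHS ℂ H (symPolydisc n) ℂ]
    (hH : IsWeightedBergmanSpace n μ H) (s t : symPolydisc n) :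
    scalarKernel H s t = inner ℂ (schurFeature hμ s) (schurFeature hμ t) := by
  have hS := isWeightedBergmanSpace_schurSpace (n := n) hμ
  have hchar : ∀ N : (symPolydisc n → ℂ) → ℝ≥0∞,
      ((∀ f : symPolydisc n → ℂ, (∃ h : H, ⇑h = f) ↔ IsHolomorphic f ∧ N f < ∞) ∧
        ∀ h : H, ‖h‖ₑ ^ 2 = N ⇑h) →
      ((∀ f : symPolydisc n → ℂ, (∃ h : SchurSpace n hμ, ⇑h = f) ↔ IsHolomorphic f ∧ N f < ∞) ∧
        ∀ h : SchurSpace n hμ, ‖h‖ₑ ^ 2 = N ⇑h) →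
      scalarKernel H s t = inner ℂ (schurFeature hμ s) (schurFeature hμ t) := by
    intro N h1 h2
    rw [← scalarKernel_schurSpace hμ]
    refine scalarKernel_eq_of_norm_eq (fun f => (h2.1 _).mpr ((h1.1 _).mp ⟨f, rfl⟩))
      (fun g => (h1.1 _).mpr ((h2.1 _).mp ⟨g, rfl⟩)) (fun f g hfg => ?_) s t
    have h3 : ‖f‖ₑ ^ 2 = ‖g‖ₑ ^ 2 := by rw [h1.2, h2.2, hfg]
    have h4 : ‖f‖ₑ = ‖g‖ₑ := (ENNReal.pow_right_strictMono two_ne_zero).injective h3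
    rw [← toReal_enorm, h4, toReal_enorm]
  rcases lt_trichotomy 1 μ with h | h | h
  · exact hchar _ (hH.1 h) (hS.1 h)
  · exact hchar _ (hH.2.1 h.symm) (hS.2.1 h.symm)
  · obtain ⟨_, z, hz, rfl⟩ := s
    obtain ⟨_, w, hw, rfl⟩ := t
    exact ((hH.2.2 h).2 ⟨z, hz⟩ ⟨w, hw⟩).trans (schurSeries_eq_inner hμ ⟨z, hz⟩ ⟨w, hw⟩)

end

/-! ### The value of the kernel at the origin -/

/-- The empty partition. -/
def zeroPart (n : ℕ) : Parts n := ⟨0, antitone_const⟩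

theorem giambelliDet_zeroPart {n : ℕ} (u : Fin n → ℂ) : giambelliDet (zeroPart n) u = 1 := by
  have h : conjLength (zeroPart n) = 0 := by
    rw [conjLength, ← Nat.le_zero]
    exact Finset.sup_le fun j _ => le_rfl
  have : IsEmpty (Fin (conjLength (zeroPart n))) := by rw [h]; infer_instance
  rw [giambelliDet, Matrix.det_isEmpty]

/-- For 𝐩 ≠ 0 the first column length p'_1 is positive, so the first row involves only coordinates
of positive index, all zero at the origin. -/
theorem giambelliDet_origin {n : ℕ} {p : Parts n} (hp : p ≠ zeroPart n) :
    giambelliDet p (0 : Fin n → ℂ) = 0 := by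
  obtain ⟨j, hj⟩ : ∃ j, p.1 j ≠ 0 := by
    by_contra h
    push Not at h
    exact hp (Subtype.ext (funext h))
  have hpos : 0 < p.1 j := Nat.pos_of_ne_zero hj
  have hr : 0 < conjLength p := hpos.trans_le (part_le_conjLength p j)
  have hc : 0 < conjPart p 0 := (Nat.zero_le _).trans_lt ((lt_part_iff_lt_conjPart p 0 j).mp hpos)
  refine Matrix.det_eq_zero_of_row_eq_zero ⟨0, hr⟩ fun k => ?_
  simp only [Matrix.of_apply, coord]
  rw [if_neg (by push_cast; omega)]
  split_ifs <;> rfl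

theorem hasSum_giambelliDet_origin {n : ℕ} (μ : ℝ) {g : Parts n → ℂ} (hg : g (zeroPart n) = 1) :
    HasSum (fun p : Parts n => (gammaSq μ p : ℂ) * g p *
      conj (giambelliDet p (0 : Fin n → ℂ))) (gammaSq μ (zeroPart n)) := by
  have := hasSum_single (f := fun p : Parts n => (gammaSq μ p : ℂ) * g p *
    conj (giambelliDet p (0 : Fin n → ℂ))) (zeroPart n) fun p hp => by
      rw [giambelliDet_origin hp, map_zero, mul_zero]
  simpa [giambelliDet_zeroPart, hg] using this

theorem inner_schurFeature_origin {n : ℕ} {μ : ℝ} (hμ : 0 < μ) (s : symPolydisc n) :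
    inner ℂ (schurFeature hμ s) (schurFeature hμ (origin n)) = (gammaSq μ (zeroPart n) : ℂ) :=
  (hasSum_inner_schurFeature hμ s (origin n)).unique
    (hasSum_giambelliDet_origin μ (giambelliDet_zeroPart _))

theorem inner_origin_schurFeature {n : ℕ} {μ : ℝ} (hμ : 0 < μ) (t : symPolydisc n) :
    inner ℂ (schurFeature hμ (origin n)) (schurFeature hμ t) = (gammaSq μ (zeroPart n) : ℂ) := by
  rw [← inner_conj_symm, inner_schurFeature_origin, Complex.conj_ofReal]

theorem normalizedKernel_eq {n : ℕ} {μ : ℝ} (hμ : 0 < μ) {H : Type*} [NormedAddCommGroup H]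
    [InnerProductSpace ℂ H] [CompleteSpace H] [RKHS ℂ H (symPolydisc n) ℂ]
    (hH : IsWeightedBergmanSpace n μ H) (s t : symPolydisc n) :
    normalizedKernel (scalarKernel H) (origin n) s t =
      ((multiFactorial (delta n) / multiPochhammer μ (delta n) : ℝ) : ℂ) * scalarKernel H s t := by
  have hk := scalarKernel_eq_inner_schurFeature hμ hH
  have hγ : ((gammaSq μ (zeroPart n) : ℝ) : ℂ) ≠ 0 := by exact_mod_cast (gammaSq_pos hμ _).ne'
  have hδ : multiFactorial (delta n) / multiPochhammer μ (delta n) =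
      (gammaSq μ (zeroPart n))⁻¹ := by
    rw [gammaSq, inv_div, show (zeroPart n).1 = 0 from rfl, zero_add]
  rw [normalizedKernel, hk (origin n) (origin n), hk s (origin n), hk (origin n) t,
    inner_schurFeature_origin, inner_schurFeature_origin, inner_origin_schurFeature, hδ,
    mul_inv_cancel₀ hγ, one_mul, mul_comm, Complex.ofReal_inv]

theorem isNormalizedAt_normalizedKernel {n : ℕ} {μ : ℝ} (hμ : 0 < μ) {H : Type*}
    [NormedAddCommGroup H] [InnerProductSpace ℂ H] [CompleteSpace H]
    [RKHS ℂ H (symPolydisc n) ℂ] (hH : IsWeightedBergmanSpace n μ H) :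
    IsNormalizedAt (normalizedKernel (scalarKernel H) (origin n)) (origin n) := by
  have hk := scalarKernel_eq_inner_schurFeature hμ hH
  have hγ : ((gammaSq μ (zeroPart n) : ℝ) : ℂ) ≠ 0 := by exact_mod_cast (gammaSq_pos hμ _).ne'
  refine Eventually.of_forall fun s => ?_
  rw [normalizedKernel, hk (origin n) (origin n), hk s (origin n), inner_schurFeature_origin,
    inner_schurFeature_origin, mul_inv_cancel₀ hγ, one_mul, mul_inv_cancel₀ hγ]

end SymmetrizedPolydisc

open SymmetrizedPolydisc in
open scoped ComplexConjugate in
theorem theorem4p10 (n : ℕ) (hn : 1 ≤ n) (μ : ℝ) (hμ : 0 < μ) :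
    (∃ (H : Type) (_ : NormedAddCommGroup H) (_ : InnerProductSpace ℂ H) (_ : CompleteSpace H)
      (_ : RKHS ℂ H (symPolydisc n) ℂ), IsWeightedBergmanSpace n μ H) ∧
    ∀ (H : Type*) [NormedAddCommGroup H] [InnerProductSpace ℂ H] [CompleteSpace H]
      [RKHS ℂ H (symPolydisc n) ℂ], IsWeightedBergmanSpace n μ H →
      IsNormalizedAt (normalizedKernel (scalarKernel H) (origin n)) (origin n) ∧
      (∀ s t : symPolydisc n, normalizedKernel (scalarKernel H) (origin n) s t =
        ((multiFactorial (delta n) / multiPochhammer μ (delta n) : ℝ) : ℂ) *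
          scalarKernel H s t) ∧
      ∀ s t : symPolydisc n,
        HasSum
          (fun p : Parts n =>
            ((multiFactorial (delta n) / multiPochhammer μ (delta n) : ℝ) : ℂ) *
              ((gammaSq μ p : ℂ) * giambelliDet p s * conj (giambelliDet p t)))
          (normalizedKernel (scalarKernel H) (origin n) s t) := by
  refine ⟨⟨SchurSpace n hμ, inferInstance, inferInstance, inferInstance, inferInstance,
    isWeightedBergmanSpace_schurSpace hμ⟩, fun H _ _ _ _ hH => ⟨isNormalizedAt_normalizedKernel hμ hH,
    normalizedKernel_eq hμ hH, fun s t => ?_⟩⟩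
  rw [normalizedKernel_eq hμ hH, scalarKernel_eq_inner_schurFeature hμ hH]
  -- `HasSum` in ℂ over the unordered index set is unconditional, hence absolute, convergence.
  exact (hasSum_inner_schurFeature hμ s t).mul_left _
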